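/- Let $\Bbbk$ be an algebraically closed field, $n\ge 0$, and let $Q$ be a quiver of type $\mathbb{A}_{n+2}$ with vertices $1,\dots,n+2$; for $\ell\in[n+1]=\{1,\dots,n+1\}$ let $\alpha_\ell$ be the arrow between $\ell$ and $\ell+1$. Call $\ell\in[n+1]$ upper-barred ($\ell\in\overline{[n+1]}$) if $\alpha_\ell\colon\ell\to\ell+1$, and lower-barred ($\ell\in\underline{[n+1]}$) if $\alpha_\ell\colon\ell\leftarrow\ell+1$. Representations of $Q$ are finite dimensional over $\Bbbk$. Let $P(Q)$ be a convex $(n+3)$-gon in the plane with vertices $0,1,\dots,n+2$ drawn from left to right, where $0$ and $n+2$ lie on a horizontal line $L$, the upper-barred vertices lie above $L$ and the lower-barred ones below $L$. For $0\le i<j\le n+2$ let $\gamma(i,j)$ be the line segment between $i$ and $j$. A triangulation (including the boundary edges) is a maximal set of pairwise non-crossing line segments. For $\pi=\pi_1\dots\pi_{n+1}\in S_{n+1}$ let $\lambda_0(\pi)$ be the path from $0$ to $n+2$ through all lower-barred vertices in increasing order; obtain $\lambda_{i}(\pi)$ from $\lambda_{i-1}(\pi)$ by adding the vertex $\pi_i$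 if $\pi_i$ is upper-barred, and deleting it if $\pi_i$ is lower-barred (keeping the vertices in increasing order). Let $\eta_Q(\pi)$ be the set of all line segments of the paths $\lambda_0(\pi),\dots,\lambda_{n+1}(\pi)$. For $1\le i\le j\le n+2$ let $M(i,j)$ be the representation with $\Bbbk$ at the vertices $i,\dots,j$, zero elsewhere, and identity maps between the copies of $\Bbbk$. Put $F(\gamma(i,j))=M(i+1,j)$, and for a set $\mathcal T$ of line segments $F(\mathcal T)=\bigoplus_{\gamma\in\mathcal T}F(\gamma)$. Let $\eta_Q^{\mathrm{rep}}(\pi)=F(\eta_Q(\pi))$. A representation $T$ is almost rigid if it has no repeated indecomposable direct summands and, for all indecomposable summands $A,B$ of $T$, either $\mathrm{Ext}^1(A,B)=0$, or $\mathrm{Ext}^1(A,B)$ is one-dimensional and generated by a short exact sequence $0\to B\to E\to A\to 0$ with $E$ indecomposable. It is maximal almost rigid if it is almost rigid and $T\oplus M$ is not almost rigid for any nonzero representation $M$. A representation $M$ is an extension of $N$ if there is a non-split short exact sequence $0\to N_1\to M\to N_2\to 0$ with $N\cong N_1\oplus N_2$. It is a degeneration of $N$ if it lies in the Zariski closure of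 the isomorphism class of $N$ (in the affine space of representations of a fixed dimension vector). Define representations $\lambda^{\mathrm{rep}}_0(\pi),\dots,\lambda^{\mathrm{rep}}_{n+1}(\pi)$ of dimension vector $(1,\dots,1)$ as follows: $\lambda_0^{\mathrm{rep}}(\pi)$ has the zero map on $\alpha_\ell$ for $\ell$ lower-barred and the identity map on all other arrows; $\lambda_i^{\mathrm{rep}}(\pi)$ is obtained from $\lambda_{i-1}^{\mathrm{rep}}(\pi)$ by putting on the arrow $\alpha_{\pi_i}$ the zero map if $\pi_i\in\overline{[n+1]}$, and the identity map if $\pi_i\in\underline{[n+1]}$. Then the following hold for every $\pi\in S_{n+1}$. 1. $\eta_Q(\pi)$ is a triangulation of $P(Q)$. 2. If $\pi_i$ is upper-barred, then $\lambda_{i-1}^{\mathrm{rep}}(\pi)$ has the identity map on $\alpha_{\pi_i}$ and $\lambda_i^{\mathrm{rep}}(\pi)$ is a degeneration of $\lambda_{i-1}^{\mathrm{rep}}(\pi)$. If $\pi_i$ is lower-barred, then $\lambda_{i-1}^{\mathrm{rep}}(\pi)$ has the zero map on $\alpha_{\pi_i}$ and $\lambda_i^{\mathrm{rep}}(\pi)$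 is an extension of $\lambda_{i-1}^{\mathrm{rep}}(\pi)$. The last representation $\lambda_{n+1}^{\mathrm{rep}}(\pi)$ has the zero map on $\alpha_\ell$ for $\ell$ upper-barred and the identity map on all other arrows. 3. $\eta_Q^{\mathrm{rep}}(\pi)$ is a maximal almost rigid representation, and an indecomposable representation is (up to isomorphism) a direct summand of $\eta_Q^{\mathrm{rep}}(\pi)$ if and only if it is a direct summand of $\lambda_i^{\mathrm{rep}}(\pi)$ for some $i\in\{0,\dots,n+1\}$. Up to isomorphism, $\eta_Q^{\mathrm{rep}}(\pi)$ is the only maximal almost rigid representation with this property. -/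

import Mathlib

universe u v w

/-! ## Representations of quivers -/

/-- A finite dimensional representation over `k` of a quiver with vertex set `V`. -/
structure QuiverRep (k : Type u) [Field k] (V : Type v) [Quiver.{w} V] where
  space : V → Type u
  [addCommGroup : ∀ x, AddCommGroup (space x)]
  [module : ∀ x, Module k (space x)]
  [finiteDimensional : ∀ x, FiniteDimensional k (space x)]
  map : ∀ {x y : V}, (x ⟶ y) → (space x →ₗ[k] space y)

attribute [instance] QuiverRep.addCommGroup QuiverRep.module QuiverRep.finiteDimensional

namespace QuiverRep

variable {k : Type u} [Field k] {V : Type v} [Quiver.{w} V]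

/-- Morphisms of representations. -/
structure Hom (M N : QuiverRep k V) where
  app : ∀ x, M.space x →ₗ[k] N.space x
  comm : ∀ {x y : V} (a : x ⟶ y), N.map a ∘ₗ app x = app y ∘ₗ M.map a

/-- Isomorphisms of representations. -/
structure Iso (M N : QuiverRep k V) where
  app : ∀ x, M.space x ≃ₗ[k] N.space x
  comm : ∀ {x y : V} (a : x ⟶ y) (m : M.space x), N.map a (app x m) = app y (M.map a m)

/-- `M ≅ N`. -/
def Isomorphic (M N : QuiverRep k V) : Prop := Nonempty (Iso M N)

/-- The zero representation (up to isomorphism). -/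
def IsZero (M : QuiverRep k V) : Prop := ∀ x, Subsingleton (M.space x)

/-- The direct sum `M ⊕ N`. -/
def sum (M N : QuiverRep k V) : QuiverRep k V where
  space x := M.space x × N.space x
  map a := (M.map a).prodMap (N.map a)

/-- The direct sum of a finite family of representations. -/
def directSum {ι : Type} [Finite ι] (M : ι → QuiverRep k V) : QuiverRep k V where
  space x := ∀ i, (M i).space x
  map a := LinearMap.pi fun i => (M i).map a ∘ₗ LinearMap.proj i

/-- `M` is nonzero and is not the direct sum of two nonzero representations. -/
def Indecomposable (M : QuiverRep k V) : Prop :=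
  ¬ M.IsZero ∧ ∀ A B : QuiverRep k V, M.Isomorphic (A.sum B) → A.IsZero ∨ B.IsZero

/-- `X` is (isomorphic to) a direct summand of `M`. -/
def IsSummand (X M : QuiverRep k V) : Prop := ∃ Y : QuiverRep k V, M.Isomorphic (X.sum Y)

/-- `X` is (isomorphic to) an indecomposable direct summand of `M`. -/
def IsIndecSummand (X M : QuiverRep k V) : Prop := X.Indecomposable ∧ X.IsSummand M

/-- `M` has no repeated indecomposable direct summands. -/
def Basic (M : QuiverRep k V) : Prop :=
  ∀ X : QuiverRep k V, X.Indecomposable → ¬ (X.sum X).IsSummand M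

/-- `0 → A → E → B → 0` is a short exact sequence. -/
def ShortExact {A E B : QuiverRep k V} (f : Hom A E) (g : Hom E B) : Prop :=
  ∀ x, Function.Injective (f.app x) ∧ Function.Surjective (g.app x) ∧
    LinearMap.range (f.app x) = LinearMap.ker (g.app x)

/-- The epimorphism `g` of a short exact sequence has a section, i.e. the sequence splits. -/
def Splits {E B : QuiverRep k V} (g : Hom E B) : Prop :=
  ∃ s : Hom B E, ∀ x, g.app x ∘ₗ s.app x = LinearMap.id

/-- The differential `∏ₓ Hom(Aₓ, Bₓ) → ∏_{a : x → y} Hom(Aₓ, B_y)`; its kernel is `Hom(A, B)` and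
its cokernel is `Ext¹(A, B)`. -/
def extDifferential (A B : QuiverRep k V) :
    (∀ x, A.space x →ₗ[k] B.space x) →ₗ[k]
      (∀ x y : V, (x ⟶ y) → (A.space x →ₗ[k] B.space y)) where
  toFun h := fun x y a => B.map a ∘ₗ h x - h y ∘ₗ A.map a
  map_add' h h' := by
    funext x y a
    ext m
    simp only [Pi.add_apply, LinearMap.sub_apply, LinearMap.comp_apply, LinearMap.add_apply,
      map_add]
    abel
  map_smul' c h := by
    funext x y a
    ext m
    simp [smul_sub]

/-- The vector space `Ext¹(A, B)` of extensions `0 → B → E → A → 0`. -/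
abbrev Ext (A B : QuiverRep k V) : Type (max u v w) :=
  (∀ x y : V, (x ⟶ y) → (A.space x →ₗ[k] B.space y)) ⧸ LinearMap.range (extDifferential A B)

/-- `ξ ∈ Ext¹(A, B)` is the class of the short exact sequence `0 → B → E → A → 0`: for linear
sections `s x` of `g` at the vertices, it is represented by the family of the maps
`f⁻¹ ∘ (E_a ∘ s x - s y ∘ A_a)`, where `a : x → y` runs over the arrows. -/
def IsExtClass {A B E : QuiverRep k V} (f : Hom B E) (g : Hom E A) (ξ : Ext A B) : Prop :=
  ShortExact f g ∧
    ∃ (s : ∀ x, A.space x →ₗ[k] E.space x)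
      (c : ∀ x y : V, (x ⟶ y) → (A.space x →ₗ[k] B.space y)),
      (∀ x, g.app x ∘ₗ s x = LinearMap.id) ∧
      (∀ (x y : V) (a : x ⟶ y), f.app y ∘ₗ c x y a = E.map a ∘ₗ s x - s y ∘ₗ A.map a) ∧
      ξ = Submodule.Quotient.mk c

/-- `T` is basic and, for all indecomposable summands `A, B` of `T`, either `Ext(A, B) = 0`, or
`Ext(A, B)` is one-dimensional and generated by a short exact sequence `0 → B → E → A → 0` whose
middle term `E` is indecomposable. -/
def AlmostRigid (T : QuiverRep k V) : Prop :=
  T.Basic ∧ ∀ A B : QuiverRep k V, A.IsIndecSummand T → B.IsIndecSummand T →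
    Subsingleton (Ext A B) ∨
      (Module.finrank k (Ext A B) = 1 ∧
        ∃ (E : QuiverRep k V) (f : Hom B E) (g : Hom E A) (ξ : Ext A B),
          IsExtClass f g ξ ∧ Submodule.span k {ξ} = ⊤ ∧ E.Indecomposable)

/-- `T` is almost rigid and `T ⊕ M` is not almost rigid for any nonzero `M`. -/
def MaximalAlmostRigid (T : QuiverRep k V) : Prop :=
  T.AlmostRigid ∧ ∀ M : QuiverRep k V, ¬ M.IsZero → ¬ (T.sum M).AlmostRigid

/-- `M` is an extension of `N`: there is a non-split short exact sequence `0 → N₁ → M → N₂ → 0`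
with `N ≅ N₁ ⊕ N₂`. -/
def IsExtensionOf (M N : QuiverRep k V) : Prop :=
  ∃ (N₁ N₂ : QuiverRep k V) (f : Hom N₁ M) (g : Hom M N₂),
    N.Isomorphic (N₁.sum N₂) ∧ ShortExact f g ∧ ¬ Splits g

/-- The representation with the vector spaces of `M` and with the linear maps `w`. -/
def withMaps (M : QuiverRep k V) (w : ∀ x y : V, (x ⟶ y) → (M.space x →ₗ[k] M.space y)) :
    QuiverRep k V where
  space := M.space
  map {x y} a := w x y a

/-- `M` is a degeneration of `N`: in the affine space `∏_{a : x → y} Hom(Mₓ, M_y)` of all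
representations on the vector spaces of `M`, the point `M` lies in the Zariski closure of the set
of those isomorphic to `N`, i.e. every polynomial function that vanishes on this set vanishes
at `M`. A polynomial function is a polynomial in linear forms. -/
def IsDegenerationOf (M N : QuiverRep k V) : Prop :=
  ∀ p : MvPolynomial
      (Module.Dual k (∀ x y : V, (x ⟶ y) → (M.space x →ₗ[k] M.space y))) k,
    (∀ w : ∀ x y : V, (x ⟶ y) → (M.space x →ₗ[k] M.space y),
      (M.withMaps w).Isomorphic N → MvPolynomial.eval (fun φ => φ w) p = 0) →
    MvPolynomial.eval (fun φ => φ (fun _ _ a => M.map a)) p = 0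

end QuiverRep

/-! ## Quivers of type `A` -/

/-- A quiver of type `A_{n+2}`. Its vertices `1, …, n+2` are the elements `0, …, n+1` of
`Fin (n + 2)` (the label of `v` is `v + 1`), and the labels `ℓ ∈ [n+1]` of its arrows are the
elements of `Fin (n + 1)` in the same way. The arrow `α_ℓ` points from `ℓ` to `ℓ + 1` if
`forward ℓ` holds, and from `ℓ + 1` to `ℓ` otherwise. -/
structure TypeAQuiver (n : ℕ) where
  forward : Fin (n + 1) → Bool

namespace TypeAQuiver

variable {n : ℕ}

/-- The vertices of `Q`. -/
def Vertex (_Q : TypeAQuiver n) : Type := Fin (n + 2)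

/-- The arrows of `Q`. -/
inductive Arrow (Q : TypeAQuiver n) : Fin (n + 2) → Fin (n + 2) → Type
  | right (l : Fin (n + 1)) (h : Q.forward l = true) : Arrow Q l.castSucc l.succ
  | left (l : Fin (n + 1)) (h : Q.forward l = false) : Arrow Q l.succ l.castSucc

/-- The index `ℓ` of the arrow `α_ℓ`. -/
def Arrow.index {Q : TypeAQuiver n} : {x y : Fin (n + 2)} → Arrow Q x y → Fin (n + 1)
  | _, _, .right l _ => l
  | _, _, .left l _ => l

instance (Q : TypeAQuiver n) : Quiver Q.Vertex where
  Hom x y := Arrow Q x y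

/-- The index `ℓ` of the arrow `α_ℓ`. -/
def arrowIndex (Q : TypeAQuiver n) {x y : Q.Vertex} (a : x ⟶ y) : Fin (n + 1) := Arrow.index a

/-- The upper-barred elements of `[n+1]`. -/
def upper (Q : TypeAQuiver n) : Finset (Fin (n + 1)) :=
  Finset.univ.filter fun l => Q.forward l = true

/-- The lower-barred elements of `[n+1]`. -/
def lower (Q : TypeAQuiver n) : Finset (Fin (n + 1)) :=
  Finset.univ.filter fun l => Q.forward l = false

/-! ### The polygon `P(Q)` and the map `η_Q` -/

/-- The vertex `ℓ` of `P(Q)` belonging to `ℓ ∈ [n+1]`. The vertices `0, 1, …, n+2` of `P(Q)` are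
the elements of `Fin (n + 3)`. -/
def polygonVertex (l : Fin (n + 1)) : Fin (n + 3) := l.succ.castSucc

/-- The line segments `γ(i, j)`, `0 ≤ i < j ≤ n + 2`. -/
abbrev Segment (n : ℕ) : Type := {p : Fin (n + 3) × Fin (n + 3) // p.1 < p.2}

/-- A way to draw the convex `(n+3)`-gon `P(Q)` in the plane: the vertices `0, …, n+2` go from left
to right, `0` and `n+2` lie on one horizontal line, the upper-barred vertices lie above it and the
lower-barred ones below it. -/
structure Polygon (Q : TypeAQuiver n) where
  pt : Fin (n + 3) → ℝ × ℝ
  left_to_right : StrictMono fun i => (pt i).1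
  horizontal : (pt 0).2 = (pt (Fin.last (n + 2))).2
  above : ∀ l ∈ Q.upper, (pt 0).2 < (pt (polygonVertex l)).2
  below : ∀ l ∈ Q.lower, (pt (polygonVertex l)).2 < (pt 0).2
  convex : ConvexIndependent ℝ pt

/-- Two line segments do not cross, i.e. they have no common interior point. -/
def Polygon.NonCrossing {Q : TypeAQuiver n} (P : Q.Polygon) (γ δ : Segment n) : Prop :=
  Disjoint (openSegment ℝ (P.pt γ.1.1) (P.pt γ.1.2)) (openSegment ℝ (P.pt δ.1.1) (P.pt δ.1.2))

/-- A triangulation (including the boundary edges) is a maximal set of line segments that pairwise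
do not cross. -/
def Polygon.IsTriangulation {Q : TypeAQuiver n} (P : Q.Polygon) (T : Set (Segment n)) : Prop :=
  Maximal (fun S : Set (Segment n) => S.Pairwise P.NonCrossing) T

/-- The elements of `[n+1]` that the path `λ_i(π)` passes through, `0 ≤ i ≤ n+1`: at first the
lower-barred ones; then, in step `i + 1`, the entry `π_{i+1}` is added if it is upper-barred and
deleted if it is lower-barred. -/
def pathSupport (Q : TypeAQuiver n) (π : Equiv.Perm (Fin (n + 1))) :
    Fin (n + 2) → Finset (Fin (n + 1)) :=
  Fin.induction Q.lower fun i S => if π i ∈ Q.upper then insert (π i) S else S.erase (π i)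

/-- The vertices of `P(Q)` on the path `λ_i(π)` from `0` to `n+2`. -/
def pathVertices (Q : TypeAQuiver n) (π : Equiv.Perm (Fin (n + 1))) (i : Fin (n + 2)) :
    Finset (Fin (n + 3)) :=
  {0, Fin.last (n + 2)} ∪ (Q.pathSupport π i).image polygonVertex

/-- The line segments of the path `λ_i(π)`: they join consecutive vertices of the path. -/
def path (Q : TypeAQuiver n) (π : Equiv.Perm (Fin (n + 1))) (i : Fin (n + 2)) :
    Finset (Segment n) :=
  Finset.univ.filter fun γ =>
    γ.1.1 ∈ Q.pathVertices π i ∧ γ.1.2 ∈ Q.pathVertices π i ∧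
      ∀ c ∈ Q.pathVertices π i, ¬ (γ.1.1 < c ∧ c < γ.1.2)

/-- `η_Q(π)`, the union of the paths `λ_0(π), …, λ_{n+1}(π)`. -/
def eta (Q : TypeAQuiver n) (π : Equiv.Perm (Fin (n + 1))) : Finset (Segment n) :=
  Finset.univ.biUnion (Q.path π)

/-! ### The representations of `Q` -/

section Representations

variable (k : Type u) [Field k]

/-- The subspace `k` of `k` if `p` holds, and `0` otherwise. -/
def lineIf (p : Prop) : Submodule k k where
  carrier := {c | ¬ p → c = 0}
  add_mem' ha hb hp := by rw [ha hp, hb hp, add_zero]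
  zero_mem' _ := rfl
  smul_mem' c x hx hp := by rw [hx hp, smul_zero]

/-- The map `lineIf p → lineIf q` that is the identity if `p` and `q` hold, and `0` otherwise. -/
def lineMap (p q : Prop) [Decidable p] [Decidable q] : lineIf k p →ₗ[k] lineIf k q where
  toFun c := ⟨if p ∧ q then (c : k) else 0, fun hq => if_neg fun h => hq h.2⟩
  map_add' c d := by
    ext
    by_cases h : p ∧ q <;> simp [h]
  map_smul' r c := by
    ext
    by_cases h : p ∧ q <;> simp [h]

/-- The vertex of `Q` has a label in `{i, …, j}`; the label of `v : Fin (n + 2)` is `v + 1`. -/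
abbrev Between (Q : TypeAQuiver n) (i j : ℕ) (x : Q.Vertex) : Prop :=
  i ≤ Fin.val (n := n + 2) x + 1 ∧ Fin.val (n := n + 2) x + 1 ≤ j

/-- The representation `M(i, j)`, `1 ≤ i ≤ j ≤ n + 2`. -/
def M (Q : TypeAQuiver n) (i j : ℕ) : QuiverRep k Q.Vertex where
  space x := lineIf k (Q.Between i j x)
  map {x y} _ := lineMap k (Q.Between i j x) (Q.Between i j y)

/-- `F` on line segments: `F(γ(i, j)) = M(i + 1, j)`. -/
def F (Q : TypeAQuiver n) (γ : Segment n) : QuiverRep k Q.Vertex :=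
  M k Q (γ.1.1 + 1) γ.1.2

/-- `F` on sets of line segments: the direct sum of the `F(γ)`. -/
def FSet (Q : TypeAQuiver n) (T : Finset (Segment n)) : QuiverRep k Q.Vertex :=
  QuiverRep.directSum fun γ : T => F k Q γ

/-- `η_Q^rep = F ∘ η_Q`. -/
def etaRep (Q : TypeAQuiver n) (π : Equiv.Perm (Fin (n + 1))) : QuiverRep k Q.Vertex :=
  FSet k Q (Q.eta π)

/-- The representation with dimension vector `(1, …, 1)`, the identity map on the arrows `α_ℓ` with
`ℓ ∈ S`, and the zero map on all other arrows. -/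
def thinRep (Q : TypeAQuiver n) (S : Finset (Fin (n + 1))) : QuiverRep k Q.Vertex where
  space _ := k
  map a := if Q.arrowIndex a ∈ S then LinearMap.id else 0

/-- The `ℓ` for which `λ_i^rep(π)` has the identity map on `α_ℓ`: at first the `ℓ` that are not
lower-barred; then, in step `i + 1`, the map on the arrow of index `π_{i+1}` is replaced by the
zero map if `π_{i+1}` is upper-barred, and by the identity map if it is lower-barred. -/
def identityArrows (Q : TypeAQuiver n) (π : Equiv.Perm (Fin (n + 1))) :
    Fin (n + 2) → Finset (Fin (n + 1)) :=
  Fin.induction (Q.lower)ᶜ fun i S => if π i ∈ Q.upper then S.erase (π i) else insert (π i) S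

/-- The representation `λ_i^rep(π)`, `0 ≤ i ≤ n + 1`. -/
def lambdaRep (Q : TypeAQuiver n) (π : Equiv.Perm (Fin (n + 1))) (i : Fin (n + 2)) :
    QuiverRep k Q.Vertex :=
  thinRep k Q (Q.identityArrows π i)

end Representations

end TypeAQuiver

/-!
For segments `γ` and `δ`, the pair `(F(γ), F(δ))` violates the condition in the definition of an
almost rigid representation exactly if `γ` crosses `δ` from below, read from left to right. Indeed,
an arrow from the support of `F(γ)` to that of `F(δ)` leaves the overlap of the supports at its
left end if and only if `γ` lies below `δ` there, and at its right end if and only if `γ` lies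
above `δ` there. If `γ` crosses `δ` from below, the two arrows give a nonzero class in
`Ext¹(F(γ), F(δ))` although the supports intersect, so that no middle term is indecomposable, as
the indecomposable representations are the `F(γ)`, of dimension at most one at every vertex. In
all other cases, either `Ext¹(F(γ), F(δ))` vanishes or the supports are adjacent, with the union
of the supports carrying the indecomposable middle term. Hence maximal almost rigid
representations correspond to triangulations.

The paths `λ_0(π), …, λ_{n+1}(π)` sweep the polygon from its lower to its upper boundary, so no
segment of one path crosses a segment of another one. A segment that is crossed by none of the paths
lies on one side of each path that does not contain it. Since it lies above the first and below the
last path, and one step changes a path at one vertex only, it is contained in one of them.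

The vertices of `λ_t(π)` are the arrows on which `λ_t^rep(π)` has the zero map, so `λ_t^rep(π)` is
the direct sum of the `F(γ)` for the segments `γ` of this path. Switching one arrow between zero
and the identity cuts a representation into a subrepresentation and a quotient, or glues these
together by a non-split extension; the direct sum of the two pieces is a degeneration, reached by
scaling the arrow by `t → 0`.
-/

/-! ## Retracts and direct sums -/

namespace QuiverRep

variable {k : Type u} [Field k] {V : Type v} [Quiver.{w} V]

section Morphisms

variable {M N L : QuiverRep k V}

lemma Hom.comm_apply (f : Hom M N) {x y : V} (a : x ⟶ y) (m : M.space x) :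
    N.map a (f.app x m) = f.app y (M.map a m) :=
  LinearMap.congr_fun (f.comm a) m

/-- The composite `g ∘ f` of two morphisms of representations. -/
def Hom.comp (g : Hom N L) (f : Hom M N) : Hom M L where
  app x := g.app x ∘ₗ f.app x
  comm a := LinearMap.ext fun m => by simp [Hom.comm_apply]

@[simp] lemma Hom.comp_app (g : Hom N L) (f : Hom M N) (x : V) (m : M.space x) :
    (g.comp f).app x m = g.app x (f.app x m) := rfl

/-- The morphism underlying an isomorphism of representations. -/
def Iso.hom (e : Iso M N) : Hom M N where
  app x := (e.app x).toLinearMap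
  comm a := LinearMap.ext (e.comm a)

@[simp] lemma Iso.hom_app (e : Iso M N) (x : V) (m : M.space x) : e.hom.app x m = e.app x m := rfl

/-- The inverse of an isomorphism of representations. -/
def Iso.symm (e : Iso M N) : Iso N M where
  app x := (e.app x).symm
  comm a m := by rw [LinearEquiv.eq_symm_apply, ← e.comm, LinearEquiv.apply_symm_apply]

@[simp] lemma Iso.symm_app (e : Iso M N) (x : V) (n : N.space x) :
    e.symm.app x n = (e.app x).symm n := rfl

/-- The composite of two isomorphisms of representations. -/
def Iso.trans (e : Iso M N) (e' : Iso N L) : Iso M L where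
  app x := (e.app x).trans (e'.app x)
  comm a m := by simp [e.comm, e'.comm]

/-- A morphism that is bijective at every vertex, as an isomorphism. -/
noncomputable def Iso.ofBijective (f : Hom M N) (h : ∀ x, Function.Bijective (f.app x)) :
    Iso M N where
  app x := LinearEquiv.ofBijective (f.app x) (h x)
  comm a m := f.comm_apply a m

@[refl] lemma Isomorphic.refl (M : QuiverRep k V) : M.Isomorphic M :=
  ⟨⟨fun _ => LinearEquiv.refl k _, fun _ _ => rfl⟩⟩

@[symm] lemma Isomorphic.symm (h : M.Isomorphic N) : N.Isomorphic M :=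
  h.map Iso.symm

@[trans] lemma Isomorphic.trans (h : M.Isomorphic N) (h' : N.Isomorphic L) : M.Isomorphic L :=
  ⟨h.some.trans h'.some⟩

lemma Isomorphic.sum {M' N' : QuiverRep k V} (h : M.Isomorphic M') (h' : N.Isomorphic N') :
    (M.sum N).Isomorphic (M'.sum N') := by
  obtain ⟨e⟩ := h
  obtain ⟨e'⟩ := h'
  exact ⟨⟨fun x => (e.app x).prodCongr (e'.app x),
    fun a m => Prod.ext (e.comm a m.1) (e'.comm a m.2)⟩⟩

lemma Isomorphic.isZero (h : M.Isomorphic N) (hM : M.IsZero) : N.IsZero := fun x =>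
  have := hM x
  (h.some.app x).symm.injective.subsingleton

lemma IsZero.isomorphic (hM : M.IsZero) (hN : N.IsZero) : M.Isomorphic N := by
  refine ⟨⟨fun x => ?_, fun {x y} a m => ?_⟩⟩
  · have := hM x
    have := hN x
    exact { (0 : M.space x →ₗ[k] N.space x) with
      invFun := 0
      left_inv := fun m => Subsingleton.elim _ _
      right_inv := fun m => Subsingleton.elim _ _ }
  · have := hN y
    exact Subsingleton.elim _ _

lemma Isomorphic.indecomposable (h : M.Isomorphic N) (hM : M.Indecomposable) :
    N.Indecomposable :=
  ⟨fun hN => hM.1 (h.symm.isZero hN), fun A B hAB => hM.2 A B (h.trans hAB)⟩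

end Morphisms

section Sum

/-- The inclusion of the first summand of `M ⊕ N`. -/
def inl (M N : QuiverRep k V) : Hom M (M.sum N) where
  app x := LinearMap.inl k (M.space x) (N.space x)
  comm a := LinearMap.ext fun _ => Prod.ext rfl (map_zero (N.map a))

/-- The inclusion of the second summand of `M ⊕ N`. -/
def inr (M N : QuiverRep k V) : Hom N (M.sum N) where
  app x := LinearMap.inr k (M.space x) (N.space x)
  comm a := LinearMap.ext fun _ => Prod.ext (map_zero (M.map a)) rfl

/-- The projection of `M ⊕ N` to the first summand. -/
def fst (M N : QuiverRep k V) : Hom (M.sum N) M where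
  app x := LinearMap.fst k (M.space x) (N.space x)
  comm _ := rfl

/-- The projection of `M ⊕ N` to the second summand. -/
def snd (M N : QuiverRep k V) : Hom (M.sum N) N where
  app x := LinearMap.snd k (M.space x) (N.space x)
  comm _ := rfl

variable {M N : QuiverRep k V}

lemma isomorphic_sum_of_isZero (hN : N.IsZero) : M.Isomorphic (M.sum N) := by
  refine ⟨Iso.ofBijective (inl M N) fun x => ⟨LinearMap.inl_injective, fun ⟨m, n⟩ => ⟨m, ?_⟩⟩⟩
  have := hN x
  exact Prod.ext rfl (Subsingleton.elim _ _)

lemma indecomposable_of_forall_end_eq_smul (hM : ¬ M.IsZero)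
    (h : ∀ f : Hom M M, ∃ c : k, ∀ x m, f.app x m = c • m) : M.Indecomposable := by
  refine ⟨hM, fun A B ⟨e⟩ => ?_⟩
  obtain ⟨c, hc⟩ := h (e.symm.hom.comp ((inl A B).comp ((fst A B).comp e.hom)))
  have smul_eq : ∀ x (p : (A.sum B).space x), c • p = (inl A B).app x ((fst A B).app x p) := by
    intro x p
    have := congrArg (e.app x) (hc x ((e.app x).symm p))
    simpa using this.symm
  rcases eq_or_ne c 0 with rfl | hc0
  · refine .inl fun x => subsingleton_of_forall_eq 0 fun a => ?_
    have := congrArg Prod.fst (smul_eq x (a, 0))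
    exact this.symm.trans (zero_smul k a)
  · refine .inr fun x => subsingleton_of_forall_eq 0 fun b => ?_
    have : c • b = 0 := congrArg Prod.snd (smul_eq x (0, b))
    exact (smul_eq_zero.1 this).resolve_left hc0

end Sum

section Retract

/-- `X` is a retract of `M`, i.e. `id_X` factors through `M`. This is equivalent to `IsSummand`
(see `isSummand_iff_isRetract`), but it does not mention a complement. -/
def IsRetract (X M : QuiverRep k V) : Prop :=
  ∃ (f : Hom X M) (g : Hom M X), ∀ x m, g.app x (f.app x m) = m

/-- The kernel of a morphism of representations. -/
def ker {M X : QuiverRep k V} (g : Hom M X) : QuiverRep k V where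
  space x := LinearMap.ker (g.app x)
  map {x y} a := (M.map a).restrict fun m hm => by
    rw [LinearMap.mem_ker] at hm ⊢
    rw [← g.comm_apply, hm, map_zero]

variable {X Y M N : QuiverRep k V}

lemma isomorphic_sum_ker {f : Hom X M} {g : Hom M X} (h : ∀ x m, g.app x (f.app x m) = m) :
    M.Isomorphic (X.sum (ker g)) := by
  let i : Hom (X.sum (ker g)) M :=
    ⟨fun x => (f.app x).coprod (LinearMap.ker (g.app x)).subtype, fun {x y} a =>
      LinearMap.ext fun p => (map_add (M.map a) (f.app x p.1) p.2.1).trans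
        (congrArg (· + M.map a p.2.1) (f.comm_apply a p.1))⟩
  refine Isomorphic.symm ⟨Iso.ofBijective i fun x =>
    ⟨(injective_iff_map_eq_zero (i.app x)).2 ?_, fun m => ?_⟩⟩
  · rintro ⟨m, n, hn⟩ (hmn : f.app x m + n = 0)
    have hm : m = 0 := by simpa [h, LinearMap.mem_ker.1 hn] using congrArg (g.app x) hmn
    subst hm
    have hn0 : n = 0 := by simpa using hmn
    exact Prod.ext rfl (Subtype.ext hn0)
  · exact ⟨(g.app x m, ⟨m - f.app x (g.app x m), by simp [h]⟩), add_sub_cancel _ _⟩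

lemma isRetract_sum_left : M.IsRetract (M.sum N) := ⟨inl M N, fst M N, fun _ _ => rfl⟩

lemma isRetract_sum_right : N.IsRetract (M.sum N) := ⟨inr M N, snd M N, fun _ _ => rfl⟩

lemma IsRetract.sum (h : X.IsRetract M) (h' : Y.IsRetract N) :
    (X.sum Y).IsRetract (M.sum N) := by
  obtain ⟨f, g, h⟩ := h
  obtain ⟨f', g', h'⟩ := h'
  exact ⟨⟨fun x => (f.app x).prodMap (f'.app x), fun a => LinearMap.ext fun m =>
      Prod.ext (f.comm_apply a m.1) (f'.comm_apply a m.2)⟩,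
    ⟨fun x => (g.app x).prodMap (g'.app x), fun a => LinearMap.ext fun m =>
      Prod.ext (g.comm_apply a m.1) (g'.comm_apply a m.2)⟩,
    fun x m => Prod.ext (h x m.1) (h' x m.2)⟩

lemma IsRetract.trans (h : X.IsRetract M) (h' : M.IsRetract N) : X.IsRetract N := by
  obtain ⟨f, g, h⟩ := h
  obtain ⟨f', g', h'⟩ := h'
  exact ⟨f'.comp f, g.comp g', fun x m => by simp [h, h']⟩

lemma Isomorphic.isRetract (h : M.Isomorphic N) : M.IsRetract N :=
  h.elim fun e => ⟨e.hom, e.symm.hom, fun x m => by simp⟩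

lemma isSummand_iff_isRetract : X.IsSummand M ↔ X.IsRetract M :=
  ⟨fun ⟨_, h⟩ => isRetract_sum_left.trans h.symm.isRetract,
    fun ⟨_, g, h⟩ => ⟨ker g, isomorphic_sum_ker h⟩⟩

lemma IsRetract.isomorphic (h : X.IsRetract M) (hX : ¬ X.IsZero) (hM : M.Indecomposable) :
    X.Isomorphic M := by
  obtain ⟨Y, hY⟩ := isSummand_iff_isRetract.2 h
  have hY0 : Y.IsZero := (hM.2 X Y hY).resolve_left hX
  exact (isomorphic_sum_of_isZero hY0).trans hY.symm

lemma IsSummand.of_isRetract (hX : X.IsSummand N) (h : N.IsRetract M) : X.IsSummand M :=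
  isSummand_iff_isRetract.2 ((isSummand_iff_isRetract.1 hX).trans h)

lemma Basic.of_isRetract (hM : M.Basic) (h : N.IsRetract M) : N.Basic :=
  fun X hX hXN => hM X hX (hXN.of_isRetract h)

end Retract

section DirectSum

variable {ι : Type} [Finite ι]

open Classical in
/-- The inclusion of the `i`-th summand of a direct sum. -/
noncomputable def directSumIncl (M : ι → QuiverRep k V) (i : ι) : Hom (M i) (directSum M) where
  app x := LinearMap.single k (fun i => (M i).space x) i
  comm {x y} a := LinearMap.ext fun m => funext fun j => by
    change (M j).map a (Pi.single (M := fun i => (M i).space x) i m j) =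
      Pi.single (M := fun i => (M i).space y) i ((M i).map a m) j
    obtain rfl | h := eq_or_ne j i
    · simp
    · simp [h]

/-- The projection of a direct sum to the `i`-th summand. -/
def directSumProj (M : ι → QuiverRep k V) (i : ι) : Hom (directSum M) (M i) where
  app _ := LinearMap.proj i
  comm _ := rfl

lemma isRetract_directSum (M : ι → QuiverRep k V) (i : ι) : (M i).IsRetract (directSum M) := by
  classical
  exact ⟨directSumIncl M i, directSumProj M i,
    fun x m => Pi.single_eq_same (M := fun i => (M i).space x) i m⟩

lemma isRetract_sum_directSum (M : ι → QuiverRep k V) {i j : ι} (hij : i ≠ j) :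
    ((M i).sum (M j)).IsRetract (directSum M) := by
  classical
  refine ⟨⟨fun x => ((directSumIncl M i).app x).coprod ((directSumIncl M j).app x),
      fun a => LinearMap.ext fun m => (map_add ((directSum M).map a) _ _).trans
        (congrArg₂ (· + ·) ((directSumIncl M i).comm_apply a m.1)
          ((directSumIncl M j).comm_apply a m.2))⟩,
    ⟨fun x => ((directSumProj M i).app x).prod ((directSumProj M j).app x), fun _ => rfl⟩,
    fun x m => ?_⟩
  change ((Pi.single i m.1 + Pi.single j m.2 : ∀ i, (M i).space x) i,
    (Pi.single i m.1 + Pi.single j m.2 : ∀ i, (M i).space x) j) = (m.1, m.2)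
  simp [hij, hij.symm]

lemma sum_directSumIncl_directSumProj [Fintype ι] (M : ι → QuiverRep k V) (x : V)
    (m : (directSum M).space x) :
    ∑ i, (directSumIncl M i).app x ((directSumProj M i).app x m) = m := by
  classical
  exact Finset.univ_sum_single (M := fun i => (M i).space x) m

lemma isZero_directSum_of_isEmpty [IsEmpty ι] (M : ι → QuiverRep k V) : (directSum M).IsZero :=
  fun x => inferInstanceAs (Subsingleton (∀ i, (M i).space x))

lemma directSum_option_isomorphic (M : Option ι → QuiverRep k V) :
    (directSum M).Isomorphic ((M none).sum (directSum fun i => M (some i))) :=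
  ⟨fun _ => LinearEquiv.piOptionEquivProd k, fun _ _ => rfl⟩

lemma directSum_reindex_isomorphic {κ : Type} [Finite κ] (e : ι ≃ κ) (N : κ → QuiverRep k V) :
    (directSum fun i => N (e i)).Isomorphic (directSum N) :=
  Isomorphic.symm ⟨fun x => LinearEquiv.piCongrLeft' k (fun j => (N j).space x) e.symm,
    fun _ _ => rfl⟩

end DirectSum

section Dimension

variable [Fintype V] {X Y A : QuiverRep k V}

/-- The sum of the entries of the dimension vector. -/
noncomputable def totalDim (X : QuiverRep k V) : ℕ := ∑ x, Module.finrank k (X.space x)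

lemma totalDim_lt_of_isomorphic_sum (h : X.Isomorphic (A.sum Y)) (hA : ¬ A.IsZero) :
    Y.totalDim < X.totalDim := by
  obtain ⟨e⟩ := h
  have finrank_eq (x : V) : Module.finrank k (X.space x) =
      Module.finrank k (A.space x) + Module.finrank k (Y.space x) :=
    (e.app x).finrank_eq.trans Module.finrank_prod
  obtain ⟨x, hx⟩ := not_forall.1 hA
  have : 0 < Module.finrank k (A.space x) :=
    Module.finrank_pos_iff.2 (not_subsingleton_iff_nontrivial.1 hx)
  exact Finset.sum_lt_sum (fun y _ => by rw [finrank_eq]; omega)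
    ⟨x, Finset.mem_univ x, by rw [finrank_eq]; omega⟩

end Dimension

end QuiverRep

/-! ## Interval modules -/

namespace TypeAQuiver

open QuiverRep

variable {n : ℕ}

/-- The vertex `ℓ` of `Q`, the left end of the arrow `α_ℓ`. -/
def before (Q : TypeAQuiver n) (l : Fin (n + 1)) : Q.Vertex := l.castSucc

/-- The vertex `ℓ + 1` of `Q`, the right end of the arrow `α_ℓ`. -/
def after (Q : TypeAQuiver n) (l : Fin (n + 1)) : Q.Vertex := l.succ

/-- The arrow `α_ℓ` if it points to the right. -/
def rightArrow (Q : TypeAQuiver n) (l : Fin (n + 1)) (h : Q.forward l = true) :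
    Q.before l ⟶ Q.after l :=
  Arrow.right l h

/-- The arrow `α_ℓ` if it points to the left. -/
def leftArrow (Q : TypeAQuiver n) (l : Fin (n + 1)) (h : Q.forward l = false) :
    Q.after l ⟶ Q.before l :=
  Arrow.left l h

variable {Q : TypeAQuiver n}

instance : Fintype Q.Vertex := inferInstanceAs (Fintype (Fin (n + 2)))

/-- The position of a vertex of `Q` in `{0, …, n + 1}`; its label is `pos x + 1`. -/
def pos (x : Q.Vertex) : ℕ := Fin.val (n := n + 2) x

@[simp] lemma pos_before (l : Fin (n + 1)) : pos (Q.before l) = l.val := rfl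

@[simp] lemma pos_after (l : Fin (n + 1)) : pos (Q.after l) = l.val + 1 := rfl

lemma pos_lt (x : Q.Vertex) : pos x < n + 2 := Fin.isLt (n := n + 2) x

lemma pos_injective : Function.Injective (pos (Q := Q)) := Fin.val_injective (n := n + 2)

lemma exists_pos_eq (Q : TypeAQuiver n) {m : ℕ} (hm : m < n + 2) : ∃ x : Q.Vertex, pos x = m :=
  ⟨(⟨m, hm⟩ : Fin (n + 2)), rfl⟩

lemma between_iff {i j : ℕ} {x : Q.Vertex} : Q.Between i j x ↔ i ≤ pos x + 1 ∧ pos x + 1 ≤ j :=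
  Iff.rfl

lemma arrow_cases {P : ∀ x y : Q.Vertex, (x ⟶ y) → Prop} {l : Fin (n + 1)}
    (right : ∀ h, P _ _ (Q.rightArrow l h)) (left : ∀ h, P _ _ (Q.leftArrow l h))
    {x y : Q.Vertex} (α : x ⟶ y) (hα : Q.arrowIndex α = l) : P x y α := by
  subst hα
  match x, y, α with
  | _, _, .right l h => exact right h
  | _, _, .left l h => exact left h

lemma pos_of_arrow {x y : Q.Vertex} (α : x ⟶ y) :
    (Q.forward (Q.arrowIndex α) = true ∧ pos x = Q.arrowIndex α ∧ pos y = Q.arrowIndex α + 1) ∨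
      (Q.forward (Q.arrowIndex α) = false ∧ pos x = Q.arrowIndex α + 1 ∧
        pos y = Q.arrowIndex α) := by
  match x, y, α with
  | _, _, .right l h => exact .inl ⟨h, rfl, rfl⟩
  | _, _, .left l h => exact .inr ⟨h, rfl, rfl⟩

@[elab_as_elim] lemma vertex_induction {P : Q.Vertex → Prop} (zero : ∀ x, pos x = 0 → P x)
    (succ : ∀ l, P (Q.before l) → P (Q.after l)) (x : Q.Vertex) : P x :=
  Fin.induction (motive := P) (zero _ rfl) succ x

lemma apply_eq_of_between {ι : Type*} {i j : ℕ} {f : Q.Vertex → ι}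
    (h : ∀ {x y : Q.Vertex}, (x ⟶ y) → Q.Between i j x → Q.Between i j y → f x = f y)
    {x y : Q.Vertex} (hx : Q.Between i j x) (hy : Q.Between i j y) : f x = f y := by
  wlog hxy : pos x ≤ pos y generalizing x y
  · exact (this hy hx (Nat.le_of_not_le hxy)).symm
  induction y using vertex_induction with
  | zero y hy0 => rw [pos_injective (by omega : pos x = pos y)]
  | succ l ih =>
    rw [pos_after] at hxy
    obtain hxl | hxl := hxy.eq_or_lt
    · rw [pos_injective (by simpa using hxl : pos x = pos (Q.after l))]
    · have hl : Q.Between i j (Q.before l) := by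
        simp only [between_iff, pos_after, pos_before] at *
        omega
      rw [ih hl (by simpa using Nat.le_of_lt_succ hxl)]
      rcases hf : Q.forward l with _ | _
      · exact (h (Q.leftArrow l hf) hy hl).symm
      · exact h (Q.rightArrow l hf) hl hy

variable {k : Type u} [Field k] {i j a b c d : ℕ}

/-- The inclusion into `k` of the space of `M(i, j)` at a vertex. -/
def val {x : Q.Vertex} : (M k Q i j).space x →ₗ[k] k :=
  (lineIf k (Q.Between i j x)).subtype

/-- The element `1` of `M(i, j)` at the vertices in `{i, …, j}`, and `0` at the other ones. -/
def gen (i j : ℕ) (x : Q.Vertex) : (M k Q i j).space x :=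
  (⟨if Q.Between i j x then 1 else 0, fun h => if_neg h⟩ : lineIf k (Q.Between i j x))

lemma val_gen {x : Q.Vertex} (h : Q.Between i j x) : val (gen (k := k) i j x) = 1 := if_pos h

lemma val_eq_zero {x : Q.Vertex} (m : (M k Q i j).space x) (h : ¬ Q.Between i j x) : val m = 0 :=
  m.2 h

lemma val_injective {x : Q.Vertex} : Function.Injective (val (k := k) (i := i) (j := j) (x := x)) :=
  Subtype.val_injective

lemma eq_zero_of_not_between {x : Q.Vertex} (m : (M k Q i j).space x) (h : ¬ Q.Between i j x) :
    m = 0 :=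
  val_injective ((val_eq_zero m h).trans (map_zero val).symm)

lemma val_smul_gen {x : Q.Vertex} (m : (M k Q i j).space x) : val m • gen i j x = m := by
  apply val_injective
  by_cases h : Q.Between i j x
  · simp [val_gen h]
  · simp [val_eq_zero _ h]

lemma val_map {x y : Q.Vertex} (α : x ⟶ y) (m : (M k Q i j).space x) :
    val ((M k Q i j).map α m) = if Q.Between i j x ∧ Q.Between i j y then val m else 0 := rfl

lemma map_gen {x y : Q.Vertex} (α : x ⟶ y) (h : Q.Between i j x) :
    (M k Q i j).map α (gen i j x) = gen i j y := by
  apply val_injective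
  rw [val_map, val_gen h]
  by_cases hy : Q.Between i j y
  · rw [if_pos ⟨h, hy⟩, val_gen hy]
  · rw [if_neg fun h => hy h.2, val_eq_zero _ hy]

lemma M_not_isZero {x : Q.Vertex} (h : Q.Between i j x) : ¬ (M k Q i j).IsZero := fun h0 => by
  have := h0 x
  have e := val_gen (k := k) h
  rw [Subsingleton.elim (gen i j x) 0, map_zero] at e
  exact zero_ne_one e

/-- The morphism from `M(i, j)` given by a family of vectors that is compatible with the arrows. -/
def homOfVectors {X : QuiverRep k Q.Vertex} (i j : ℕ) (e : ∀ x, X.space x)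
    (h0 : ∀ x, ¬ Q.Between i j x → e x = 0)
    (h : ∀ {x y : Q.Vertex} (α : x ⟶ y), Q.Between i j x → X.map α (e x) = e y) :
    Hom (M k Q i j) X where
  app x := LinearMap.toSpanSingleton k _ (e x) ∘ₗ val
  comm {x y} α := LinearMap.ext fun m => by
    simp only [LinearMap.comp_apply, LinearMap.toSpanSingleton_apply, map_smul, val_map]
    by_cases hx : Q.Between i j x
    · by_cases hy : Q.Between i j y
      · rw [h α hx, if_pos ⟨hx, hy⟩]
      · simp [h α hx, h0 y hy]
    · simp [val_eq_zero _ hx]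

/-- The morphism to `M(i, j)` given by a family of linear forms that is compatible with the
arrows. -/
def homOfForms {X : QuiverRep k Q.Vertex} (i j : ℕ) (φ : ∀ x, X.space x →ₗ[k] k)
    (h0 : ∀ x, ¬ Q.Between i j x → φ x = 0)
    (h : ∀ {x y : Q.Vertex} (α : x ⟶ y), Q.Between i j y → φ y ∘ₗ X.map α = φ x) :
    Hom X (M k Q i j) where
  app x := (φ x).codRestrict (lineIf k (Q.Between i j x)) fun m hx => by simp [h0 x hx]
  comm {x y} α := LinearMap.ext fun m => Subtype.ext <| by
    change (if Q.Between i j x ∧ Q.Between i j y then φ x m else 0) = φ y (X.map α m)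
    by_cases hy : Q.Between i j y
    · have e : φ y (X.map α m) = φ x m := LinearMap.congr_fun (h α hy) m
      by_cases hx : Q.Between i j x
      · rw [e, if_pos ⟨hx, hy⟩]
      · simp [e, h0 x hx]
    · simp [h0 y hy, hy]

/-- The scalar by which a morphism `M(i, j) → M(a, b)` acts at a vertex. -/
def coef (f : Hom (M k Q i j) (M k Q a b)) (x : Q.Vertex) : k := val (f.app x (gen i j x))

lemma val_app (f : Hom (M k Q i j) (M k Q a b)) (x : Q.Vertex) (m : (M k Q i j).space x) :
    val (f.app x m) = val m * coef f x := by
  conv_lhs => rw [← val_smul_gen m]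
  rw [map_smul, map_smul, smul_eq_mul, coef]

lemma coef_comp (g : Hom (M k Q a b) (M k Q c d)) (f : Hom (M k Q i j) (M k Q a b))
    (x : Q.Vertex) : coef (g.comp f) x = coef f x * coef g x :=
  val_app g x _

lemma between_of_coef_ne_zero {f : Hom (M k Q i j) (M k Q a b)} {x : Q.Vertex}
    (h : coef f x ≠ 0) : Q.Between i j x ∧ Q.Between a b x := by
  refine ⟨?_, ?_⟩ <;> by_contra hx
  · exact h (by rw [coef, eq_zero_of_not_between (gen i j x) hx, map_zero, map_zero])
  · exact h (val_eq_zero _ hx)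

lemma coef_eq_of_arrow (f : Hom (M k Q i j) (M k Q a b)) {x y : Q.Vertex} (α : x ⟶ y)
    (hx : Q.Between i j x) (hy : Q.Between a b y) : coef f x = coef f y := by
  have h := congrArg val (f.comm_apply α (gen i j x))
  rw [map_gen α hx, val_map] at h
  rw [coef, coef, ← h]
  by_cases hx' : Q.Between a b x
  · rw [if_pos ⟨hx', hy⟩]
  · rw [if_neg fun h => hx' h.1, val_eq_zero _ hx']

lemma coef_end_eq (f : Hom (M k Q i j) (M k Q i j)) {x y : Q.Vertex}
    (hx : Q.Between i j x) (hy : Q.Between i j y) : coef f x = coef f y :=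
  apply_eq_of_between (coef_eq_of_arrow f) hx hy

lemma between_imp_of_coef_mul_coef_ne_zero {f : Hom (M k Q i j) (M k Q a b)}
    {g : Hom (M k Q a b) (M k Q i j)} {x y : Q.Vertex} (h : coef f x * coef g x ≠ 0)
    (hy : Q.Between i j y) : Q.Between a b y := by
  have hx := (between_of_coef_ne_zero (left_ne_zero_of_mul h)).1
  rw [← coef_comp, coef_end_eq _ hx hy, coef_comp] at h
  exact (between_of_coef_ne_zero (left_ne_zero_of_mul h)).2

lemma between_iff_of_coef_mul_coef_ne_zero {f : Hom (M k Q i j) (M k Q a b)}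
    {g : Hom (M k Q a b) (M k Q i j)} {x : Q.Vertex} (h : coef f x * coef g x ≠ 0)
    (y : Q.Vertex) : Q.Between i j y ↔ Q.Between a b y :=
  ⟨between_imp_of_coef_mul_coef_ne_zero h,
    between_imp_of_coef_mul_coef_ne_zero (f := g) (g := f) (by rwa [mul_comm])⟩

lemma M_indecomposable {x : Q.Vertex} (hx : Q.Between i j x) : (M k Q i j).Indecomposable := by
  refine indecomposable_of_forall_end_eq_smul (M_not_isZero hx) fun f =>
    ⟨coef f x, fun y m => val_injective ?_⟩
  rw [val_app, map_smul, smul_eq_mul, mul_comm]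
  by_cases hy : Q.Between i j y
  · rw [coef_end_eq f hx hy]
  · rw [val_eq_zero m hy, mul_zero, mul_zero]

end TypeAQuiver

/-! ## Indecomposable representations -/

namespace TypeAQuiver

open QuiverRep

section LinearForms

variable {K U W : Type*} [Field K] [AddCommGroup U] [Module K U] [AddCommGroup W] [Module K W]

lemma exists_form_eq_one_of_notMem {S : Submodule K W} {v : W} (hv : v ∉ S) :
    ∃ ψ : W →ₗ[K] K, ψ v = 1 ∧ S ≤ LinearMap.ker ψ := by
  obtain ⟨ψ, hψ, hS⟩ := S.exists_le_ker_of_notMem hv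
  exact ⟨(ψ v)⁻¹ • ψ, inv_mul_cancel₀ hψ, fun x hx => by simp [LinearMap.mem_ker.1 (hS hx)]⟩

lemma exists_form_comp_eq {S : Submodule K W} {f : U →ₗ[K] W} {φ : U →ₗ[K] K}
    (h : S.comap f ≤ LinearMap.ker φ) : ∃ ψ : W →ₗ[K] K, ψ ∘ₗ f = φ ∧ S ≤ LinearMap.ker ψ := by
  have hφ : φ ∈ LinearMap.range (S.mkQ ∘ₗ f).dualMap := by
    rw [LinearMap.range_dualMap_eq_dualAnnihilator_ker, Submodule.mem_dualAnnihilator]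
    simpa [LinearMap.ker_comp, SetLike.le_def] using h
  obtain ⟨ψ, rfl⟩ := hφ
  exact ⟨ψ ∘ₗ S.mkQ, rfl, fun x hx => by simp [(Submodule.Quotient.mk_eq_zero S).2 hx]⟩

end LinearForms

variable {n : ℕ} {Q : TypeAQuiver n} {k : Type u} [Field k]

/-- Vectors and linear forms that exhibit `M(i, j)` as a retract of the restriction of `X` to the
vertices with a label at most `j`: only the arrows between such vertices are considered. -/
structure PartialSplitting (X : QuiverRep k Q.Vertex) (i j : ℕ) where
  vec : ∀ x, X.space x
  form : ∀ x, X.space x →ₗ[k] k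
  vec_eq_zero : ∀ x, ¬ Q.Between i j x → vec x = 0
  form_eq_zero : ∀ x, ¬ Q.Between i j x → form x = 0
  map_vec : ∀ {x y : Q.Vertex} (α : x ⟶ y), Q.arrowIndex α + 1 < j → Q.Between i j x →
    X.map α (vec x) = vec y
  form_map : ∀ {x y : Q.Vertex} (α : x ⟶ y), Q.arrowIndex α + 1 < j → Q.Between i j y →
    form y ∘ₗ X.map α = form x
  form_vec : ∀ x, Q.Between i j x → form x (vec x) = 1

namespace PartialSplitting

variable {X : QuiverRep k Q.Vertex} {i j : ℕ}

lemma isRetract (s : PartialSplitting X i j)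
    (hX : ∀ x : Q.Vertex, j ≤ pos x → Subsingleton (X.space x)) : (M k Q i j).IsRetract X := by
  have map_vec {x y : Q.Vertex} (α : x ⟶ y) (hx : Q.Between i j x) :
      X.map α (s.vec x) = s.vec y := by
    by_cases hα : Q.arrowIndex α + 1 < j
    · exact s.map_vec α hα hx
    · have := pos_of_arrow α
      have := hX y (by simp only [between_iff] at hx; omega)
      exact Subsingleton.elim _ _
  have form_map {x y : Q.Vertex} (α : x ⟶ y) (hy : Q.Between i j y) :
      s.form y ∘ₗ X.map α = s.form x := by
    by_cases hα : Q.arrowIndex α + 1 < j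
    · exact s.form_map α hα hy
    · have := pos_of_arrow α
      have := hX x (by simp only [between_iff] at hy; omega)
      exact LinearMap.ext fun m => by simp [Subsingleton.elim m 0]
  refine ⟨homOfVectors i j s.vec s.vec_eq_zero map_vec,
    homOfForms i j s.form s.form_eq_zero form_map, fun x m => val_injective ?_⟩
  change s.form x (val m • s.vec x) = val m
  by_cases hx : Q.Between i j x
  · rw [map_smul, s.form_vec x hx, smul_eq_mul, mul_one]
  · rw [val_eq_zero m hx, zero_smul, map_zero]

/-- The partial splitting of the empty interval. -/
def empty (X : QuiverRep k Q.Vertex) (hij : j < i) : PartialSplitting X i j where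
  vec _ := 0
  form _ := 0
  vec_eq_zero _ _ := rfl
  form_eq_zero _ _ := rfl
  map_vec _ _ _ := map_zero _
  form_map _ _ _ := LinearMap.zero_comp _
  form_vec _ h := absurd (h.1.trans h.2) (by omega)

lemma exists_apply_eq_and_eqOn {ι : Type*} {A : ι → Type*} (f : ∀ x, A x) (a : ι) (v : A a) :
    ∃ g : ∀ x, A x, g a = v ∧ ∀ x ≠ a, g x = f x := by
  classical
  exact ⟨Function.update f a v, Function.update_self .., fun x hx => Function.update_of_ne hx ..⟩

lemma exists_of_pos_eq_zero {x : Q.Vertex} (hx : pos x = 0) {v : X.space x}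
    {ψ : X.space x →ₗ[k] k} (hψv : ψ v = 1) :
    ∃ s : PartialSplitting X 1 1, s.vec x = v ∧ s.form x = ψ := by
  obtain ⟨vec, vec_self, vec_of_ne⟩ := exists_apply_eq_and_eqOn (fun y => (0 : X.space y)) x v
  obtain ⟨form, form_self, form_of_ne⟩ :=
    exists_apply_eq_and_eqOn (fun y => (0 : X.space y →ₗ[k] k)) x ψ
  have ne_of {y : Q.Vertex} (hy : ¬ Q.Between 1 1 y) : y ≠ x := fun h =>
    hy (by simp [between_iff, h, hx])
  exact ⟨{
    vec := vec
    form := form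
    vec_eq_zero y hy := vec_of_ne y (ne_of hy)
    form_eq_zero y hy := form_of_ne y (ne_of hy)
    map_vec α hα := by omega
    form_map α hα := by omega
    form_vec y hy := by
      obtain rfl : y = x := pos_injective (by simp only [between_iff] at hy; omega)
      rw [vec_self, form_self, hψv] }, vec_self, form_self⟩

lemma between_succ_iff {l : Fin (n + 1)} {x : Q.Vertex} (hx : x ≠ Q.after l) :
    Q.Between i (l + 2) x ↔ Q.Between i (l + 1) x := by
  have := pos_injective.ne hx
  simp only [between_iff, pos_after] at *
  omega

lemma arrowIndex_eq_or_lt {l : Fin (n + 1)} {x y : Q.Vertex} (α : x ⟶ y)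
    (hα : (Q.arrowIndex α + 1 : ℕ) < l + 2) : Q.arrowIndex α = l ∨
      ((Q.arrowIndex α + 1 : ℕ) < l + 1 ∧ x ≠ Q.after l ∧ y ≠ Q.after l) := by
  have := pos_of_arrow α
  refine or_iff_not_imp_left.2 fun h => ?_
  have := Fin.val_ne_of_ne h
  refine ⟨by omega, ne_of_apply_ne pos ?_, ne_of_apply_ne pos ?_⟩ <;>
  · rw [pos_after]
    omega

lemma exists_extension {l : Fin (n + 1)} (s : PartialSplitting X i (l + 1)) (hi : i ≤ l + 2)
    {v : X.space (Q.after l)} {ψ : X.space (Q.after l) →ₗ[k] k} (hψv : ψ v = 1)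
    (right : ∀ h, (i ≤ l + 1 → X.map (Q.rightArrow l h) (s.vec (Q.before l)) = v) ∧
      ψ ∘ₗ X.map (Q.rightArrow l h) = s.form (Q.before l))
    (left : ∀ h, X.map (Q.leftArrow l h) v = s.vec (Q.before l) ∧
      (i ≤ l + 1 → s.form (Q.before l) ∘ₗ X.map (Q.leftArrow l h) = ψ)) :
    ∃ t : PartialSplitting X i (l + 2), t.vec (Q.after l) = v ∧ t.form (Q.after l) = ψ := by
  obtain ⟨vec, vec_after, vec_of_ne⟩ := exists_apply_eq_and_eqOn s.vec (Q.after l) v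
  obtain ⟨form, form_after, form_of_ne⟩ := exists_apply_eq_and_eqOn s.form (Q.after l) ψ
  have before_ne : Q.before l ≠ Q.after l := fun h => by simpa using congrArg pos h
  have between_after : Q.Between i (l + 2) (Q.after l) := ⟨hi, le_rfl⟩
  exact ⟨{
    vec := vec
    form := form
    vec_eq_zero x hx := by
      have hxl : x ≠ Q.after l := by rintro rfl; exact hx between_after
      rw [vec_of_ne x hxl, s.vec_eq_zero x (by rwa [← between_succ_iff hxl])]
    form_eq_zero x hx := by
      have hxl : x ≠ Q.after l := by rintro rfl; exact hx between_after
      rw [form_of_ne x hxl, s.form_eq_zero x (by rwa [← between_succ_iff hxl])]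
    map_vec {x y} α hα := by
      obtain h | ⟨h, hx, hy⟩ := arrowIndex_eq_or_lt α hα
      · refine arrow_cases (P := fun x y α => Q.Between i (l + 2) x → X.map α (vec x) = vec y)
          (fun hl hx => ?_) (fun hl _ => ?_) α h
        · rw [vec_of_ne _ before_ne, vec_after]
          exact (right hl).1 hx.1
        · rw [vec_of_ne _ before_ne, vec_after]
          exact (left hl).1
      · rw [vec_of_ne x hx, vec_of_ne y hy, between_succ_iff hx]
        exact s.map_vec α h
    form_map {x y} α hα := by
      obtain h | ⟨h, hx, hy⟩ := arrowIndex_eq_or_lt α hα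
      · refine arrow_cases (P := fun x y α =>
          Q.Between i (l + 2) y → form y ∘ₗ X.map α = form x)
          (fun hl _ => ?_) (fun hl hx => ?_) α h
        · rw [form_of_ne _ before_ne, form_after]
          exact (right hl).2
        · rw [form_of_ne _ before_ne, form_after]
          exact (left hl).2 hx.1
      · rw [form_of_ne x hx, form_of_ne y hy, between_succ_iff hy]
        exact s.form_map α h
    form_vec x hx := by
      by_cases hxl : x = Q.after l
      · rw [hxl, vec_after, form_after, hψv]
      · rw [vec_of_ne x hxl, form_of_ne x hxl, s.form_vec x ((between_succ_iff hxl).1 hx)] },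
    vec_after, form_after⟩

lemma exists_start {l : Fin (n + 1)} {v : X.space (Q.after l)} {ψ : X.space (Q.after l) →ₗ[k] k}
    (hψv : ψ v = 1) (right : ∀ h, ψ ∘ₗ X.map (Q.rightArrow l h) = 0)
    (left : ∀ h, X.map (Q.leftArrow l h) v = 0) :
    ∃ t : PartialSplitting X (l + 2) (l + 2), t.vec (Q.after l) = v ∧ t.form (Q.after l) = ψ :=
  (empty X (by omega)).exists_extension le_rfl hψv (fun h => ⟨by omega, right h⟩)
    (fun h => ⟨left h, by omega⟩)

end PartialSplitting

/-- `X` has a partial splitting of an interval with right end `x`, whose vector at `x` lies in `W'`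
and whose form at `x` vanishes on `W`. -/
def HasSplitting (X : QuiverRep k Q.Vertex) (x : Q.Vertex) (W W' : Submodule k (X.space x)) :
    Prop :=
  ∃ i, 1 ≤ i ∧ i ≤ pos x + 1 ∧ ∃ s : PartialSplitting X i (pos x + 1),
    s.vec x ∈ W' ∧ W ≤ LinearMap.ker (s.form x)

variable {X : QuiverRep k Q.Vertex}

lemma hasSplitting_of_pos_eq_zero {x : Q.Vertex} (hx : pos x = 0) {W W' : Submodule k (X.space x)}
    (hW : W < W') : HasSplitting X x W W' := by
  obtain ⟨v, hv, hvW⟩ := SetLike.exists_of_lt hW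
  obtain ⟨ψ, hψv, hψ⟩ := exists_form_eq_one_of_notMem hvW
  obtain ⟨s, rfl, rfl⟩ := PartialSplitting.exists_of_pos_eq_zero hx hψv
  rw [HasSplitting, hx]
  exact ⟨1, le_rfl, le_rfl, s, hv, hψ⟩

variable {l : Fin (n + 1)} {W W' : Submodule k (X.space (Q.after l))}

lemma hasSplitting_after_of_left
    (ih : ∀ {U U' : Submodule k (X.space (Q.before l))}, U < U' → HasSplitting X _ U U')
    (h : Q.forward l = false) (hW : W < W') : HasSplitting X _ W W' := by
  set g := X.map (Q.leftArrow l h)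
  by_cases hg : W' ⊓ LinearMap.ker g ≤ W
  · have map_lt : W.map g < W'.map g := by
      refine (Submodule.map_mono hW.le).lt_of_not_ge fun hle => hW.not_ge fun v hv => ?_
      obtain ⟨w, hw, hwv⟩ := hle (Submodule.mem_map_of_mem hv)
      have : v - w ∈ W := hg ⟨sub_mem hv (hW.le hw), by simp [hwv]⟩
      simpa using add_mem this hw
    obtain ⟨i, hi, hil, s, ⟨v, hv, hvs⟩, hs⟩ := ih map_lt
    obtain ⟨t, rfl, ht⟩ := s.exists_extension (Nat.le_succ_of_le hil) (v := v)
      (ψ := s.form (Q.before l) ∘ₗ g)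
      ((congrArg _ hvs).trans (s.form_vec _ ⟨hil, le_rfl⟩))
      (fun h' => by simp [h] at h') (fun _ => ⟨hvs, fun _ => rfl⟩)
    refine ⟨i, hi, Nat.le_succ_of_le hil, t, hv, ?_⟩
    rw [ht, LinearMap.ker_comp, ← Submodule.map_le_iff_le_comap]
    exact hs
  · obtain ⟨v, ⟨hv, hgv⟩, hvW⟩ := SetLike.not_le_iff_exists.1 hg
    obtain ⟨ψ, hψv, hψ⟩ := exists_form_eq_one_of_notMem hvW
    obtain ⟨t, rfl, rfl⟩ := PartialSplitting.exists_start hψv (fun h' => by simp [h] at h')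
      (fun _ => hgv)
    exact ⟨_, Nat.le_add_left _ _, le_rfl, t, hv, hψ⟩

lemma hasSplitting_after_of_right
    (ih : ∀ {U U' : Submodule k (X.space (Q.before l))}, U < U' → HasSplitting X _ U U')
    (h : Q.forward l = true) (hW : W < W') : HasSplitting X _ W W' := by
  set f := X.map (Q.rightArrow l h)
  by_cases hf : W' ≤ W ⊔ LinearMap.range f
  · have comap_lt : W.comap f < W'.comap f := by
      refine (Submodule.comap_mono hW.le).lt_of_not_ge fun hle => hW.not_ge fun v hv => ?_
      obtain ⟨w, hw, _, ⟨u, rfl⟩, rfl⟩ := Submodule.mem_sup.1 (hf hv)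
      have hu : u ∈ W'.comap f := (Submodule.add_mem_iff_right _ (hW.le hw)).1 hv
      exact add_mem hw (hle hu)
    obtain ⟨i, hi, hil, s, hsv, hs⟩ := ih comap_lt
    obtain ⟨ψ, hψ, hψW⟩ := exists_form_comp_eq hs
    obtain ⟨t, htv, rfl⟩ := s.exists_extension (Nat.le_succ_of_le hil)
      (v := f (s.vec (Q.before l))) (ψ := ψ)
      ((LinearMap.congr_fun hψ _).trans (s.form_vec _ ⟨hil, le_rfl⟩))
      (fun _ => ⟨fun _ => rfl, hψ⟩) (fun h' => by simp [h] at h')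
    exact ⟨i, hi, Nat.le_succ_of_le hil, t, htv ▸ hsv, hψW⟩
  · obtain ⟨v, hv, hvW⟩ := SetLike.not_le_iff_exists.1 hf
    obtain ⟨ψ, hψv, hψ⟩ := exists_form_eq_one_of_notMem hvW
    obtain ⟨t, rfl, rfl⟩ := PartialSplitting.exists_start hψv
      (fun _ => LinearMap.range_le_ker_iff.1 (le_sup_right.trans hψ)) (fun h' => by simp [h] at h')
    exact ⟨_, Nat.le_add_left _ _, le_rfl, t, hv, le_sup_left.trans hψ⟩

/-- Only the claim for all pairs of nested subspaces, not for `⊥ < ⊤` alone, can be carried along an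
arrow of the quiver, by images and preimages. -/
lemma hasSplitting_of_lt {x : Q.Vertex} {W W' : Submodule k (X.space x)} (hW : W < W') :
    HasSplitting X x W W' := by
  induction x using vertex_induction with
  | zero x hx => exact hasSplitting_of_pos_eq_zero hx hW
  | succ l ih =>
    rcases h : Q.forward l with _ | _
    · exact hasSplitting_after_of_left ih h hW
    · exact hasSplitting_after_of_right ih h hW

lemma exists_M_isRetract (hX : ¬ X.IsZero) :
    ∃ i j, 1 ≤ i ∧ i ≤ j ∧ j ≤ n + 2 ∧ (M k Q i j).IsRetract X := by
  obtain ⟨x, hx, hmax⟩ := Set.Finite.exists_maximalFor pos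
    {x : Q.Vertex | ¬ Subsingleton (X.space x)} (Set.toFinite _) (not_forall.1 hX)
  have := not_subsingleton_iff_nontrivial.1 hx
  obtain ⟨i, hi, hix, s, -⟩ := hasSplitting_of_lt (X := X) (x := x) bot_lt_top
  exact ⟨i, pos x + 1, hi, hix, pos_lt x, s.isRetract fun y hy => by
    by_contra hy'
    exact hy.not_gt (Nat.lt_succ_of_le (hmax hy' (Nat.le_of_succ_le hy)))⟩

end TypeAQuiver

namespace TypeAQuiver

open QuiverRep

variable {n : ℕ} {Q : TypeAQuiver n} {k : Type u} [Field k]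

/-- The vertex `x` of `Q` lies in the support of `F(γ)`. -/
abbrev Mem (x : Q.Vertex) (γ : Segment n) : Prop := Q.Between (γ.1.1 + 1) γ.1.2 x

lemma mem_iff {x : Q.Vertex} {γ : Segment n} :
    Mem x γ ↔ γ.1.1.val ≤ pos x ∧ pos x < γ.1.2.val := by
  rw [Mem, between_iff]
  omega

lemma exists_mem (Q : TypeAQuiver n) (γ : Segment n) : ∃ x : Q.Vertex, Mem x γ := by
  have h : γ.1.1.val < γ.1.2.val := γ.2
  obtain ⟨x, hx⟩ := Q.exists_pos_eq (show γ.1.1.val < n + 2 by omega)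
  exact ⟨x, mem_iff.2 ⟨hx.ge, hx.trans_lt h⟩⟩

lemma segment_ext {γ δ : Segment n} (h₁ : γ.1.1.val = δ.1.1.val) (h₂ : γ.1.2.val = δ.1.2.val) :
    γ = δ :=
  Subtype.ext (Prod.ext (Fin.ext h₁) (Fin.ext h₂))

lemma segment_eq_of_forall_mem_iff {γ δ : Segment n} (h : ∀ x : Q.Vertex, Mem x γ ↔ Mem x δ) :
    γ = δ := by
  have : γ.1.1.val < γ.1.2.val := γ.2
  have : δ.1.1.val < δ.1.2.val := δ.2
  have mem_iff_mem {m : ℕ} (hm : m < n + 2) :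
      γ.1.1.val ≤ m ∧ m < γ.1.2.val ↔ δ.1.1.val ≤ m ∧ m < δ.1.2.val := by
    obtain ⟨x, rfl⟩ := Q.exists_pos_eq hm
    simpa only [mem_iff] using h x
  have h₁ := mem_iff_mem (m := γ.1.1) (by omega)
  have h₂ := mem_iff_mem (m := δ.1.1) (by omega)
  have h₃ := mem_iff_mem (m := γ.1.2 - 1) (by omega)
  have h₄ := mem_iff_mem (m := δ.1.2 - 1) (by omega)
  apply segment_ext <;> omega

/-- The representation `F(γ)` as a reducible abbreviation, to which the lemmas on `M(i, j)` apply
directly. -/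
abbrev segmentRep (k : Type u) [Field k] (Q : TypeAQuiver n) (γ : Segment n) :
    QuiverRep k Q.Vertex :=
  M k Q (γ.1.1 + 1) γ.1.2

lemma segmentRep_indecomposable (γ : Segment n) : (segmentRep k Q γ).Indecomposable :=
  M_indecomposable (exists_mem Q γ).choose_spec

lemma exists_segmentRep_isRetract {X : QuiverRep k Q.Vertex} (hX : ¬ X.IsZero) :
    ∃ γ, (segmentRep k Q γ).IsRetract X := by
  obtain ⟨i, j, hi, hij, hj, h⟩ := exists_M_isRetract hX
  obtain ⟨i, rfl⟩ := Nat.exists_eq_add_of_le' hi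
  exact ⟨⟨(⟨i, by omega⟩, ⟨j, by omega⟩), hij⟩, h⟩

lemma exists_isomorphic_segmentRep {X : QuiverRep k Q.Vertex} (hX : X.Indecomposable) :
    ∃ γ, X.Isomorphic (segmentRep k Q γ) := by
  obtain ⟨γ, h⟩ := exists_segmentRep_isRetract hX.1
  exact ⟨γ, (h.isomorphic (segmentRep_indecomposable γ).1 hX).symm⟩

section DirectSum

variable {ι : Type} [Finite ι] {c : ι → Segment n}

lemma exists_isomorphic_directSum_segmentRep (X : QuiverRep k Q.Vertex) :
    ∃ (ι : Type) (_ : Fintype ι) (c : ι → Segment n),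
      X.Isomorphic (directSum fun i => segmentRep k Q (c i)) := by
  induction hd : X.totalDim using Nat.strong_induction_on generalizing X with
  | _ d ih =>
    by_cases hX : X.IsZero
    · refine ⟨Empty, inferInstance, Empty.elim, ?_⟩
      exact hX.isomorphic (isZero_directSum_of_isEmpty _)
    · obtain ⟨γ, h⟩ := exists_segmentRep_isRetract hX
      obtain ⟨Y, hY⟩ := isSummand_iff_isRetract.2 h
      obtain ⟨ι, _, c, hc⟩ :=
        ih _ (hd ▸ totalDim_lt_of_isomorphic_sum hY (segmentRep_indecomposable γ).1) Y rfl
      exact ⟨Option ι, inferInstance, fun o => o.elim γ c,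
        (hY.trans ((Isomorphic.refl _).sum hc)).trans
          (directSum_option_isomorphic fun o => segmentRep k Q (o.elim γ c)).symm⟩

lemma val_app_app_gen [Fintype ι] {γ : Segment n}
    (f : Hom (segmentRep k Q γ) (directSum fun i => segmentRep k Q (c i)))
    (g : Hom (directSum fun i => segmentRep k Q (c i)) (segmentRep k Q γ)) (x : Q.Vertex) :
    val (g.app x (f.app x (gen _ _ x))) =
      ∑ i, coef ((directSumProj (fun i => segmentRep k Q (c i)) i).comp f) x *
        coef (g.comp (directSumIncl (fun i => segmentRep k Q (c i)) i)) x := by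
  conv_lhs => rw [← sum_directSumIncl_directSumProj (fun i => segmentRep k Q (c i)) x (f.app x _)]
  rw [map_sum, map_sum]
  exact Finset.sum_congr rfl fun i _ =>
    val_app (g.comp (directSumIncl (fun i => segmentRep k Q (c i)) i)) x _

lemma eq_of_coef_mul_coef_ne_zero {γ δ : Segment n} {f : Hom (segmentRep k Q γ) (segmentRep k Q δ)}
    {g : Hom (segmentRep k Q δ) (segmentRep k Q γ)} {x : Q.Vertex}
    (h : coef f x * coef g x ≠ 0) : γ = δ :=
  segment_eq_of_forall_mem_iff (between_iff_of_coef_mul_coef_ne_zero h)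

lemma segmentRep_isRetract_directSum_iff {γ : Segment n} :
    (segmentRep k Q γ).IsRetract (directSum fun i => segmentRep k Q (c i)) ↔ ∃ i, c i = γ := by
  have := Fintype.ofFinite ι
  constructor
  · rintro ⟨f, g, h⟩
    obtain ⟨x, hx⟩ := exists_mem Q γ
    have sum_eq_one := val_app_app_gen f g x
    rw [h, val_gen hx] at sum_eq_one
    obtain ⟨i, -, hi⟩ := Finset.exists_ne_zero_of_sum_ne_zero (sum_eq_one.symm.trans_ne one_ne_zero)
    exact ⟨i, (eq_of_coef_mul_coef_ne_zero hi).symm⟩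
  · rintro ⟨i, rfl⟩
    exact isRetract_directSum (fun i => segmentRep k Q (c i)) i

lemma exists_val_app_app_gen_eq_mul (hc : Function.Injective c) (γ : Segment n) (x : Q.Vertex) :
    ∃ (a : Hom (segmentRep k Q γ) (directSum fun i => segmentRep k Q (c i)) → k)
      (b : Hom (directSum fun i => segmentRep k Q (c i)) (segmentRep k Q γ) → k),
      ∀ f g, val (g.app x (f.app x (gen _ _ x))) = a f * b g := by
  have := Fintype.ofFinite ι
  by_cases hγ : ∃ i, c i = γ
  · obtain ⟨i, rfl⟩ := hγ
    refine ⟨_, _, fun f g => (val_app_app_gen f g x).trans (Fintype.sum_eq_single i fun j hj => ?_)⟩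
    by_contra hne
    exact hj (hc (eq_of_coef_mul_coef_ne_zero hne)).symm
  · refine ⟨0, 0, fun f g => (val_app_app_gen f g x).trans ?_⟩
    rw [Pi.zero_apply, zero_mul]
    refine Finset.sum_eq_zero fun i _ => ?_
    by_contra hne
    exact hγ ⟨i, (eq_of_coef_mul_coef_ne_zero hne).symm⟩

lemma basic_directSum_segmentRep_iff :
    (directSum fun i => segmentRep k Q (c i)).Basic ↔ Function.Injective c := by
  constructor
  · intro h i j hij
    by_contra hne
    have := isRetract_sum_directSum (fun i => segmentRep k Q (c i)) hne
    rw [← hij] at this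
    exact h _ (segmentRep_indecomposable _) (isSummand_iff_isRetract.2 this)
  · intro hc X hX hXX
    obtain ⟨γ, hγ⟩ := exists_isomorphic_segmentRep hX
    obtain ⟨f, g, h⟩ := (hγ.symm.isRetract.sum hγ.symm.isRetract).trans
      (isSummand_iff_isRetract.1 hXX)
    obtain ⟨x, hx⟩ := exists_mem Q γ
    obtain ⟨a, b, hab⟩ := exists_val_app_app_gen_eq_mul (k := k) hc γ x
    have h₁₁ := hab (f.comp (inl _ _)) ((fst _ _).comp g)
    have h₁₂ := hab (f.comp (inl _ _)) ((snd _ _).comp g)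
    have h₂₂ := hab (f.comp (inr _ _)) ((snd _ _).comp g)
    simp only [Hom.comp_app, h] at h₁₁ h₁₂ h₂₂
    rw [show (fst _ _).app x ((inl _ _).app x (gen _ _ x)) = gen _ _ x from rfl, val_gen hx] at h₁₁
    rw [show (snd _ _).app x ((inl _ _).app x (gen _ _ x)) = 0 from rfl, map_zero] at h₁₂
    rw [show (snd _ _).app x ((inr _ _).app x (gen _ _ x)) = gen _ _ x from rfl, val_gen hx] at h₂₂
    -- The 2 × 2 identity matrix does not have the rank one form `a i * b j`.
    grind

end DirectSum

lemma isIndecSummand_FSet_iff {X : QuiverRep k Q.Vertex} {T : Finset (Segment n)} :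
    X.IsIndecSummand (FSet k Q T) ↔ ∃ γ ∈ T, X.Isomorphic (segmentRep k Q γ) := by
  constructor
  · rintro ⟨hX, h⟩
    obtain ⟨γ, hγ⟩ := exists_isomorphic_segmentRep hX
    obtain ⟨δ, rfl⟩ := segmentRep_isRetract_directSum_iff.1
      (hγ.symm.isRetract.trans (isSummand_iff_isRetract.1 h))
    exact ⟨δ, δ.2, hγ⟩
  · rintro ⟨γ, hγT, hγ⟩
    exact ⟨hγ.symm.indecomposable (segmentRep_indecomposable γ), isSummand_iff_isRetract.2
      (hγ.isRetract.trans (isRetract_directSum (fun γ : T => segmentRep k Q γ) ⟨γ, hγT⟩))⟩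

lemma basic_FSet (T : Finset (Segment n)) : (FSet k Q T).Basic :=
  basic_directSum_segmentRep_iff.2 Subtype.val_injective

lemma isomorphic_FSet_of_basic {X : QuiverRep k Q.Vertex} (hX : X.Basic) {T : Finset (Segment n)}
    (h : ∀ γ, (segmentRep k Q γ).IsRetract X ↔ γ ∈ T) : X.Isomorphic (FSet k Q T) := by
  obtain ⟨ι, _, c, hc⟩ := exists_isomorphic_directSum_segmentRep X
  have c_injective := basic_directSum_segmentRep_iff.1 (hX.of_isRetract hc.symm.isRetract)
  have mem_iff_exists (γ : Segment n) : γ ∈ T ↔ ∃ i, c i = γ := by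
    rw [← h, ← segmentRep_isRetract_directSum_iff (k := k) (Q := Q)]
    exact ⟨fun h => h.trans hc.isRetract, fun h => h.trans hc.symm.isRetract⟩
  let e : ι ≃ T := Equiv.ofBijective (fun i => ⟨c i, (mem_iff_exists _).2 ⟨i, rfl⟩⟩)
    ⟨fun i j hij => c_injective (congrArg Subtype.val hij),
      fun γ => ((mem_iff_exists γ).1 γ.2).imp fun i hi => Subtype.ext hi⟩
  exact hc.trans (directSum_reindex_isomorphic e fun γ => segmentRep k Q γ)

end TypeAQuiver

/-! ## Extensions of interval modules -/

namespace QuiverRep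

variable {k : Type u} [Field k] {V : Type v} [Quiver.{w} V] {A B A' B' E : QuiverRep k V}

/-- `Ext(A, B)` is zero, or one-dimensional and generated by a short exact sequence with
indecomposable middle term: the condition on pairs of summands of an almost rigid
representation. -/
def ExtCompatible (A B : QuiverRep k V) : Prop :=
  Subsingleton (Ext A B) ∨
    (Module.finrank k (Ext A B) = 1 ∧
      ∃ (E : QuiverRep k V) (f : Hom B E) (g : Hom E A) (ξ : Ext A B),
        IsExtClass f g ξ ∧ Submodule.span k {ξ} = ⊤ ∧ E.Indecomposable)

/-- The action of isomorphisms `A ≅ A'` and `B ≅ B'` on the families of maps that represent the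
elements of `Ext(A, B)`. -/
def cocycleEquiv (e : Iso A A') (e' : Iso B B') :
    (∀ x y : V, (x ⟶ y) → (A.space x →ₗ[k] B.space y)) ≃ₗ[k]
      (∀ x y : V, (x ⟶ y) → (A'.space x →ₗ[k] B'.space y)) :=
  LinearEquiv.piCongrRight fun x => LinearEquiv.piCongrRight fun y =>
    LinearEquiv.piCongrRight fun _ => LinearEquiv.arrowCongr (e.app x) (e'.app y)

lemma cocycleEquiv_apply (e : Iso A A') (e' : Iso B B')
    (c : ∀ x y : V, (x ⟶ y) → (A.space x →ₗ[k] B.space y)) (x y : V) (a : x ⟶ y)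
    (m : A'.space x) :
    cocycleEquiv e e' c x y a m = e'.app y (c x y a ((e.app x).symm m)) := rfl

lemma Iso.symm_app_map (e : Iso A A') {x y : V} (a : x ⟶ y) (m : A'.space x) :
    (e.app y).symm (A'.map a m) = A.map a ((e.app x).symm m) :=
  (e.symm.comm a m).symm

lemma map_range_extDifferential_le (e : Iso A A') (e' : Iso B B') :
    (LinearMap.range (extDifferential A B)).map (cocycleEquiv e e').toLinearMap ≤
      LinearMap.range (extDifferential A' B') := by
  rintro _ ⟨_, ⟨h, rfl⟩, rfl⟩
  refine ⟨fun x => (e'.app x).toLinearMap ∘ₗ h x ∘ₗ (e.app x).symm.toLinearMap, ?_⟩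
  ext x y a m
  simp [extDifferential, cocycleEquiv_apply, e'.comm, e.symm_app_map]

/-- The isomorphism `Ext(A, B) ≅ Ext(A', B')` induced by `A ≅ A'` and `B ≅ B'`. -/
def extEquiv (e : Iso A A') (e' : Iso B B') : Ext A B ≃ₗ[k] Ext A' B' :=
  Submodule.Quotient.equiv _ _ (cocycleEquiv e e') <|
    le_antisymm (map_range_extDifferential_le e e') fun c hc =>
      ⟨(cocycleEquiv e e').symm c, map_range_extDifferential_le e.symm e'.symm ⟨c, hc, rfl⟩,
        LinearEquiv.apply_symm_apply _ _⟩

lemma ShortExact.of_iso {f : Hom B E} {g : Hom E A} (h : ShortExact f g) (e : Iso A A')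
    (e' : Iso B B') : ShortExact (f.comp e'.symm.hom) (e.hom.comp g) := by
  intro x
  obtain ⟨f_injective, g_surjective, range_eq_ker⟩ := h x
  refine ⟨f_injective.comp (e'.app x).symm.injective, (e.app x).surjective.comp g_surjective, ?_⟩
  have range_eq : LinearMap.range ((f.comp e'.symm.hom).app x) = LinearMap.range (f.app x) :=
    LinearMap.range_comp_of_range_eq_top _ (LinearEquiv.range (e'.app x).symm)
  have ker_eq : LinearMap.ker ((e.hom.comp g).app x) = LinearMap.ker (g.app x) :=
    LinearMap.ker_comp_of_ker_eq_bot _ (e.app x).ker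
  rw [range_eq, ker_eq, range_eq_ker]

lemma IsExtClass.of_iso {f : Hom B E} {g : Hom E A} {ξ : Ext A B} (h : IsExtClass f g ξ)
    (e : Iso A A') (e' : Iso B B') :
    IsExtClass (f.comp e'.symm.hom) (e.hom.comp g) (extEquiv e e' ξ) := by
  obtain ⟨h, s, c, hs, hc, rfl⟩ := h
  refine ⟨h.of_iso e e', fun x => s x ∘ₗ (e.app x).symm.toLinearMap, cocycleEquiv e e' c,
    fun x => ?_, fun x y a => ?_, rfl⟩
  · ext m
    simpa using congrArg (e.app x) (LinearMap.congr_fun (hs x) ((e.app x).symm m))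
  · ext m
    simpa [cocycleEquiv_apply, e.symm_app_map] using
      LinearMap.congr_fun (hc x y a) ((e.app x).symm m)

lemma ExtCompatible.of_isomorphic (h : ExtCompatible A B) (hA : A.Isomorphic A')
    (hB : B.Isomorphic B') : ExtCompatible A' B' := by
  obtain ⟨e⟩ := hA
  obtain ⟨e'⟩ := hB
  rcases h with h | ⟨h, E, f, g, ξ, hξ, span_eq_top, hE⟩
  · exact .inl (extEquiv e e').symm.injective.subsingleton
  · refine .inr ⟨(extEquiv e e').finrank_eq.symm.trans h, E, _, _, _, hξ.of_iso e e', ?_, hE⟩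
    rw [← Set.image_singleton, ← LinearEquiv.coe_coe, Submodule.span_image, span_eq_top,
      Submodule.map_top, LinearEquiv.range]

lemma subsingleton_ext_iff :
    Subsingleton (Ext A B) ↔ Function.Surjective (extDifferential A B) := by
  rw [Submodule.Quotient.subsingleton_iff, LinearMap.range_eq_top]

lemma ShortExact.finrank_eq_add {f : Hom B E} {g : Hom E A} (h : ShortExact f g) (x : V) :
    Module.finrank k (E.space x) =
      Module.finrank k (A.space x) + Module.finrank k (B.space x) := by
  obtain ⟨f_injective, g_surjective, range_eq_ker⟩ := h x
  rw [← LinearMap.finrank_range_add_finrank_ker (g.app x),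
    LinearMap.range_eq_top.2 g_surjective, finrank_top, ← range_eq_ker,
    LinearMap.finrank_range_of_inj f_injective]

end QuiverRep

namespace TypeAQuiver

open QuiverRep

variable {n : ℕ} {Q : TypeAQuiver n} {k : Type u} [Field k] {i j a b c d : ℕ}

/-- The linear map from `M(i, j)` at `x` to `M(a, b)` at `y` that is the identity of `k` if both
spaces are nonzero. -/
def transfer (x y : Q.Vertex) : (M k Q i j).space x →ₗ[k] (M k Q a b).space y :=
  LinearMap.toSpanSingleton k _ (gen a b y) ∘ₗ val

lemma val_transfer {x y : Q.Vertex} (m : (M k Q i j).space x) :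
    val (transfer (a := a) (b := b) x y m) = if Q.Between a b y then val m else 0 := by
  split_ifs with hy
  · simp [transfer, val_gen hy]
  · exact val_eq_zero _ hy

lemma val_apply_gen_eq_zero {x y : Q.Vertex}
    (f : (M k Q i j).space x →ₗ[k] (M k Q a b).space y)
    (h : ¬ (Q.Between i j x ∧ Q.Between a b y)) : val (f (gen i j x)) = 0 := by
  by_cases hx : Q.Between i j x
  · exact val_eq_zero _ fun hy => h ⟨hx, hy⟩
  · rw [eq_zero_of_not_between (gen i j x) hx, map_zero, map_zero]

lemma linearMap_ext_gen {x y : Q.Vertex} {f g : (M k Q i j).space x →ₗ[k] (M k Q a b).space y}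
    (h : Q.Between i j x → Q.Between a b y → val (f (gen i j x)) = val (g (gen i j x))) :
    f = g := by
  ext m
  rw [← val_smul_gen m, map_smul, map_smul]
  congr 1
  apply val_injective
  by_cases hxy : Q.Between i j x ∧ Q.Between a b y
  · exact h hxy.1 hxy.2
  · rw [val_apply_gen_eq_zero f hxy, val_apply_gen_eq_zero g hxy]

lemma val_extDifferential (h : ∀ x, (M k Q i j).space x →ₗ[k] (M k Q a b).space x)
    {x y : Q.Vertex} (α : x ⟶ y) (hx : Q.Between i j x) (hy : Q.Between a b y) :
    val (extDifferential _ _ h x y α (gen i j x)) =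
      val (h x (gen i j x)) - val (h y (gen i j y)) := by
  change val ((M k Q a b).map α (h x (gen i j x)) - h y ((M k Q i j).map α (gen i j x))) = _
  rw [map_sub, map_gen α hx, val_map]
  by_cases hx' : Q.Between a b x
  · rw [if_pos ⟨hx', hy⟩]
  · rw [if_neg fun h => hx' h.1, val_eq_zero _ hx']

lemma mem_range_extDifferential
    (c : ∀ x y : Q.Vertex, (x ⟶ y) → ((M k Q i j).space x →ₗ[k] (M k Q a b).space y))
    (η : Q.Vertex → k) (hη : ∀ x, ¬ (Q.Between i j x ∧ Q.Between a b x) → η x = 0)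
    (h : ∀ {x y : Q.Vertex} (α : x ⟶ y), Q.Between i j x → Q.Between a b y →
      η x - η y = val (c x y α (gen i j x))) :
    c ∈ LinearMap.range (extDifferential (M k Q i j) (M k Q a b)) := by
  have val_smul_transfer (x : Q.Vertex) : val ((η x • transfer x x :
      (M k Q i j).space x →ₗ[k] (M k Q a b).space x) (gen i j x)) = η x := by
    by_cases hx : Q.Between i j x ∧ Q.Between a b x
    · rw [LinearMap.smul_apply, map_smul, val_transfer, if_pos hx.2, val_gen hx.1, smul_eq_mul,
        mul_one]
    · rw [val_apply_gen_eq_zero _ hx, hη x hx]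
  refine ⟨fun x => η x • transfer x x, ?_⟩
  ext x y α : 3
  refine linearMap_ext_gen fun hx hy => ?_
  rw [val_extDifferential _ α hx hy, val_smul_transfer, val_smul_transfer, h α hx hy]

/-- A quiver of type `A` is a tree, so its first cohomology with values in `k` vanishes. -/
lemma exists_potential (c : ∀ x y : Q.Vertex, (x ⟶ y) → k) :
    ∃ G : Q.Vertex → k, ∀ {x y : Q.Vertex} (α : x ⟶ y), G x - G y = c x y α := by
  let s (l : Fin (n + 1)) : k :=
    if h : Q.forward l = true then c _ _ (Q.rightArrow l h)
    else -c _ _ (Q.leftArrow l (by simpa using h))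
  let G : Q.Vertex → k := Fin.induction (motive := fun _ => k) 0 fun l g => g - s l
  have G_after (l : Fin (n + 1)) : G (Q.after l) = G (Q.before l) - s l := rfl
  refine ⟨G, fun {x y} α => arrow_cases (P := fun x y α => G x - G y = c x y α)
    (fun h => ?_) (fun h => ?_) α rfl⟩
  · rw [G_after, sub_sub_cancel]
    exact dif_pos h
  · rw [G_after, sub_sub_cancel_left, neg_eq_iff_eq_neg]
    exact dif_neg (by simp [h])

/-- The arrows from the support of `M(i, j)` to that of `M(a, b)` leave the intersection of the
two supports only through `v`: the potential that vanishes at `v` can be cut off outside the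
intersection. -/
lemma subsingleton_ext_of_common_outer_vertex (v : Q.Vertex)
    (h : ∀ {x y : Q.Vertex}, (x ⟶ y) → Q.Between i j x → Q.Between a b y →
      (Q.Between a b x ∨ x = v) ∧ (Q.Between i j y ∨ y = v)) :
    Subsingleton (Ext (M k Q i j) (M k Q a b)) := by
  rw [subsingleton_ext_iff]
  intro c
  obtain ⟨G, hG⟩ := exists_potential fun x y α => val (c x y α (gen i j x))
  refine mem_range_extDifferential c
    (fun x => if Q.Between i j x ∧ Q.Between a b x then G x - G v else 0)
    (fun x hx => if_neg hx) fun {x y} α hx hy => ?_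
  have at_x : (if Q.Between i j x ∧ Q.Between a b x then G x - G v else 0) = G x - G v := by
    rw [ite_eq_left_iff]
    intro hx'
    rw [(h α hx hy).1.resolve_left fun h => hx' ⟨hx, h⟩, sub_self]
  have at_y : (if Q.Between i j y ∧ Q.Between a b y then G y - G v else 0) = G y - G v := by
    rw [ite_eq_left_iff]
    intro hy'
    rw [(h α hx hy).2.resolve_left fun h => hy' ⟨h, hy⟩, sub_self]
  rw [at_x, at_y, sub_sub_sub_cancel_right, hG]

/-- The morphism `M(i, j) → M(a, b)` that is the identity of `k` on the intersection of the
supports. -/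
def canonicalHom (h : ∀ {x y : Q.Vertex}, (x ⟶ y) → Q.Between i j x → Q.Between a b y →
    (Q.Between a b x ↔ Q.Between i j y)) : Hom (M k Q i j) (M k Q a b) where
  app x := transfer x x
  comm {x y} α := linearMap_ext_gen fun hx hy => by
    rw [LinearMap.comp_apply, LinearMap.comp_apply, map_gen α hx, val_map, val_transfer,
      val_transfer, if_pos hy, val_gen hx]
    by_cases hx' : Q.Between a b x
    · rw [if_pos ⟨hx', hy⟩, if_pos hx', val_gen ((h α hx hy).1 hx')]
    · rw [if_neg fun h => hx' h.1, val_eq_zero _ (mt (h α hx hy).2 hx')]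

lemma val_canonicalHom (h : ∀ {x y : Q.Vertex}, (x ⟶ y) → Q.Between i j x → Q.Between a b y →
      (Q.Between a b x ↔ Q.Between i j y)) {x : Q.Vertex} (m : (M k Q i j).space x) :
    val ((canonicalHom h).app x m) = if Q.Between a b x then val m else 0 :=
  val_transfer m

section AdjacentIntervals

variable {f : Hom (M k Q a b) (M k Q c d)} {g : Hom (M k Q c d) (M k Q i j)}
  (union : ∀ x : Q.Vertex, Q.Between c d x ↔ Q.Between i j x ∨ Q.Between a b x)
  (disjoint : ∀ x : Q.Vertex, Q.Between i j x → ¬ Q.Between a b x)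
  (val_f : ∀ (x : Q.Vertex) m, val (f.app x m) = val m)
  (val_g : ∀ (x : Q.Vertex) m, val (g.app x m) = if Q.Between i j x then val m else 0)

include union val_g in
lemma app_transfer (x : Q.Vertex) (m : (M k Q i j).space x) : g.app x (transfer x x m) = m := by
  apply val_injective
  rw [val_g, val_transfer]
  split_ifs with hx hx'
  · rfl
  · exact absurd ((union x).2 (.inl hx)) hx'
  · exact (val_eq_zero m hx).symm

include union disjoint val_f val_g in
lemma shortExact_of_disjoint : ShortExact f g := by
  refine fun x => ⟨fun m m' h => val_injective ?_, fun m => ⟨_, app_transfer union val_g x m⟩, ?_⟩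
  · rw [← val_f, h, val_f]
  · ext m
    rw [LinearMap.mem_range, LinearMap.mem_ker]
    constructor
    · rintro ⟨m, rfl⟩
      apply val_injective
      rw [val_g, val_f, map_zero, ite_eq_right_iff]
      exact fun hx => val_eq_zero m (disjoint x hx)
    · intro hm
      refine ⟨transfer x x m, val_injective ?_⟩
      rw [val_f, val_transfer, ite_eq_left_iff]
      intro hxB
      by_cases hxA : Q.Between i j x
      · rw [← map_zero val, ← hm, val_g, if_pos hxA]
      · exact (val_eq_zero m fun hx => ((union x).1 hx).elim hxA hxB).symm

include union disjoint val_f val_g in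
lemma isExtClass_transfer :
    IsExtClass f g (Submodule.Quotient.mk fun x y _ => transfer x y) := by
  refine ⟨shortExact_of_disjoint union disjoint val_f val_g, fun x => transfer x x,
    fun x y _ => transfer x y, fun x => LinearMap.ext (app_transfer union val_g x),
    fun x y α => linearMap_ext_gen fun hx hy => ?_, rfl⟩
  have val_map_transfer : val ((M k Q c d).map α (transfer x x (gen (k := k) i j x))) = 1 := by
    have hxE := (union x).2 (.inl hx)
    rw [val_map, if_pos ⟨hxE, hy⟩, val_transfer, if_pos hxE, val_gen hx]
  rw [LinearMap.comp_apply, LinearMap.sub_apply, LinearMap.comp_apply, LinearMap.comp_apply,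
    map_sub, val_map_transfer, map_gen α hx, val_transfer, if_pos hy, val_f, val_transfer,
    val_gen hx]
  by_cases hyA : Q.Between i j y
  · rw [if_neg (disjoint y hyA), val_gen hyA, sub_self]
  · rw [if_pos (((union y).1 hy).resolve_left hyA), val_eq_zero _ hyA, sub_zero]

end AdjacentIntervals

section UniqueArrow

variable (disjoint : ∀ x : Q.Vertex, Q.Between i j x → ¬ Q.Between a b x) {x₀ y₀ : Q.Vertex}
  (α₀ : x₀ ⟶ y₀) (hx₀ : Q.Between i j x₀) (hy₀ : Q.Between a b y₀)
  (unique : ∀ {x y : Q.Vertex}, (x ⟶ y) → Q.Between i j x → Q.Between a b y → x = x₀ ∧ y = y₀)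

include disjoint α₀ hx₀ hy₀ in
lemma mk_transfer_ne_zero : (Submodule.Quotient.mk fun x y _ => transfer x y :
    Ext (M k Q i j) (M k Q a b)) ≠ 0 := by
  rw [Ne, Submodule.Quotient.mk_eq_zero]
  rintro ⟨h, hh⟩
  have val_eq := val_extDifferential h α₀ hx₀ hy₀
  rw [hh, val_transfer, if_pos hy₀, val_gen hx₀,
    val_apply_gen_eq_zero _ fun h => disjoint _ h.1 h.2,
    val_apply_gen_eq_zero _ fun h => disjoint _ h.1 h.2, sub_zero] at val_eq
  exact one_ne_zero val_eq

include unique in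
lemma exists_smul_mk_transfer_eq (ξ : Ext (M k Q i j) (M k Q a b)) :
    ∃ r : k, r • Submodule.Quotient.mk (fun x y _ => transfer x y) = ξ := by
  obtain ⟨c, rfl⟩ := Submodule.Quotient.mk_surjective _ ξ
  obtain ⟨G, hG⟩ := exists_potential fun x y α => val (c x y α (gen _ _ x))
  refine ⟨G x₀ - G y₀, ?_⟩
  rw [← Submodule.Quotient.mk_smul, Submodule.Quotient.eq]
  refine mem_range_extDifferential _ (fun _ => 0) (fun _ _ => rfl) fun {x y} α hx hy => ?_
  obtain ⟨rfl, rfl⟩ := unique α hx hy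
  change _ = val ((G x - G y) • transfer x y (gen i j x) - c x y α (gen i j x))
  rw [map_sub, map_smul, val_transfer, if_pos hy, val_gen hx, ← hG α, smul_eq_mul, mul_one,
    sub_self, sub_self]

include disjoint α₀ hx₀ hy₀ unique in
lemma extCompatible_of_unique_arrow
    (union : ∀ x : Q.Vertex, Q.Between c d x ↔ Q.Between i j x ∨ Q.Between a b x)
    (no_arrow_back : ∀ {x y : Q.Vertex}, (x ⟶ y) → Q.Between a b x → ¬ Q.Between i j y) :
    ExtCompatible (M k Q i j) (M k Q a b) := by
  let f : Hom (M k Q a b) (M k Q c d) := canonicalHom fun {x y} α hx hy =>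
    ⟨fun _ => ((union y).1 hy).resolve_left (no_arrow_back α hx), fun _ => (union x).2 (.inr hx)⟩
  let g : Hom (M k Q c d) (M k Q i j) := canonicalHom fun {x y} α hx hy =>
    ⟨fun _ => (union y).2 (.inl hy),
      fun _ => ((union x).1 hx).resolve_right fun h => no_arrow_back α h hy⟩
  have val_f (x : Q.Vertex) (m : (M k Q a b).space x) : val (f.app x m) = val m := by
    rw [val_canonicalHom, ite_eq_left_iff]
    exact fun hx => (val_eq_zero m fun h => hx ((union x).2 (.inr h))).symm
  have span_eq_top := exists_smul_mk_transfer_eq (k := k) unique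
  exact .inr ⟨finrank_eq_one _ (mk_transfer_ne_zero disjoint α₀ hx₀ hy₀) span_eq_top, _, f, g, _,
    isExtClass_transfer union disjoint val_f fun _ => val_canonicalHom _,
    (Submodule.span_singleton_eq_top_iff k _).2 span_eq_top,
    M_indecomposable ((union x₀).2 (.inl hx₀))⟩

end UniqueArrow

lemma finrank_M_le_one (x : Q.Vertex) : Module.finrank k ((M k Q i j).space x) ≤ 1 := by
  simpa using LinearMap.finrank_le_finrank_of_injective (val_injective (k := k) (x := x))

lemma finrank_M_eq_one {x : Q.Vertex} (hx : Q.Between i j x) :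
    Module.finrank k ((M k Q i j).space x) = 1 := by
  refine finrank_eq_one (gen i j x) (fun h => ?_) fun m => ⟨val m, val_smul_gen m⟩
  exact one_ne_zero ((val_gen hx).symm.trans ((congrArg val h).trans (map_zero val)))

lemma not_indecomposable_of_shortExact {E : QuiverRep k Q.Vertex} {f : Hom (M k Q a b) E}
    {g : Hom E (M k Q i j)} (h : ShortExact f g) {x : Q.Vertex} (hx : Q.Between i j x)
    (hx' : Q.Between a b x) : ¬ E.Indecomposable := by
  intro hE
  obtain ⟨γ, ⟨e⟩⟩ := exists_isomorphic_segmentRep hE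
  have finrank_eq := h.finrank_eq_add x
  rw [(e.app x).finrank_eq, finrank_M_eq_one hx, finrank_M_eq_one hx'] at finrank_eq
  exact absurd (finrank_eq.symm.trans_le (finrank_M_le_one x)) (by norm_num)

lemma ends_eq_of_arrowIndex_eq {x y x' y' : Q.Vertex} (α : x ⟶ y) (β : x' ⟶ y')
    (h : Q.arrowIndex α = Q.arrowIndex β) : x = x' ∧ y = y' := by
  rcases pos_of_arrow α with ⟨hα, hx, hy⟩ | ⟨hα, hx, hy⟩ <;>
    rcases pos_of_arrow β with ⟨hβ, hx', hy'⟩ | ⟨hβ, hx', hy'⟩ <;>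
    rw [h] at hα hx hy <;> try exact absurd (hα.symm.trans hβ) (by decide)
  all_goals exact ⟨pos_injective (hx.trans hx'.symm), pos_injective (hy.trans hy'.symm)⟩

lemma exists_eq_ite_of_const_on_arrows {N : Q.Vertex → k}
    (N_eq_zero : ∀ x, ¬ (Q.Between i j x ∧ Q.Between a b x) → N x = 0)
    (N_const : ∀ {x y : Q.Vertex}, (x ⟶ y) → Q.Between i j x ∧ Q.Between a b x →
      Q.Between i j y ∧ Q.Between a b y → N x = N y) :
    ∃ t, ∀ x, N x = if Q.Between i j x ∧ Q.Between a b x then t else 0 := by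
  have between_inter_iff (x : Q.Vertex) :
      Q.Between i j x ∧ Q.Between a b x ↔ Q.Between (max i a) (min j b) x := by
    simp only [between_iff]
    omega
  by_cases h : ∃ z, Q.Between i j z ∧ Q.Between a b z
  · obtain ⟨z, hz⟩ := h
    refine ⟨N z, fun x => ?_⟩
    split_ifs with hx
    · simp only [between_inter_iff] at N_const hx hz
      exact apply_eq_of_between N_const hx hz
    · exact N_eq_zero x hx
  · exact ⟨0, fun x => (N_eq_zero x fun hx => h ⟨x, hx⟩).trans (ite_self _).symm⟩

/-- A coboundary that vanishes on the arrow `α₁` also vanishes on `α₀`, because its potential is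
constant on the intersection of the supports. -/
lemma not_subsingleton_ext_of_two_arrows {x₀ y₀ x₁ y₁ : Q.Vertex} (α₀ : x₀ ⟶ y₀) (α₁ : x₁ ⟶ y₁)
    (hα : Q.arrowIndex α₁ ≠ Q.arrowIndex α₀)
    (hx₀ : Q.Between i j x₀) (hy₀ : Q.Between a b y₀)
    (h₀ : ¬ (Q.Between a b x₀ ↔ Q.Between i j y₀))
    (hx₁ : Q.Between i j x₁) (hy₁ : Q.Between a b y₁)
    (h₁ : ¬ (Q.Between a b x₁ ↔ Q.Between i j y₁)) :
    ¬ Subsingleton (Ext (M k Q i j) (M k Q a b)) := by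
  classical
  rw [subsingleton_ext_iff]
  intro surjective
  obtain ⟨H, hH⟩ := surjective fun x y α =>
    if Q.arrowIndex α = Q.arrowIndex α₀ then transfer x y else 0
  have coboundary {x y : Q.Vertex} (α : x ⟶ y) (hx : Q.Between i j x) (hy : Q.Between a b y) :
      val (H x (gen i j x)) - val (H y (gen i j y)) =
        if Q.arrowIndex α = Q.arrowIndex α₀ then 1 else 0 := by
    rw [← val_extDifferential H α hx hy, hH]
    beta_reduce
    split_ifs
    · rw [val_transfer, if_pos hy, val_gen hx]
    · exact map_zero val
  obtain ⟨t, ht⟩ := exists_eq_ite_of_const_on_arrows (N := fun x => val (H x (gen i j x)))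
    (fun x => val_apply_gen_eq_zero (H x)) fun {x y} α hx hy => by
      refine sub_eq_zero.1 ((coboundary α hx.1 hy.2).trans (if_neg fun hα => h₀ ?_))
      obtain ⟨rfl, rfl⟩ := ends_eq_of_arrowIndex_eq α α₀ hα
      exact iff_of_true hx.2 hy.1
  have sub_eq {x y : Q.Vertex} (hx : Q.Between i j x) (hy : Q.Between a b y)
      (h : ¬ (Q.Between a b x ↔ Q.Between i j y)) :
      val (H x (gen i j x)) - val (H y (gen i j y)) = t ∨
        val (H x (gen i j x)) - val (H y (gen i j y)) = -t := by
    rw [ht, ht]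
    by_cases hx' : Q.Between a b x
    · rw [if_pos ⟨hx, hx'⟩, if_neg fun hy' => h (iff_of_true hx' hy'.1), sub_zero]
      exact .inl rfl
    · rw [if_neg fun h => hx' h.2, if_pos ⟨by_contra fun hy' => h (iff_of_false hx' hy'), hy⟩,
        zero_sub]
      exact .inr rfl
  have t_eq_zero : t = 0 := by
    have := sub_eq hx₁ hy₁ h₁
    rw [coboundary α₁ hx₁ hy₁, if_neg hα] at this
    exact this.elim Eq.symm zero_eq_neg.1
  have := sub_eq hx₀ hy₀ h₀
  rw [coboundary α₀ hx₀ hy₀, if_pos rfl, t_eq_zero, neg_zero, or_self] at this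
  exact one_ne_zero this

end TypeAQuiver

/-! ## Crossings of segments -/

namespace TypeAQuiver

open QuiverRep

variable {n : ℕ} {Q : TypeAQuiver n}

/-- The upper-barred vertices of `P(Q)`. -/
def IsUpper (Q : TypeAQuiver n) (v : Fin (n + 3)) : Prop := ∃ l ∈ Q.upper, polygonVertex l = v

/-- The lower-barred vertices of `P(Q)`. -/
def IsLower (Q : TypeAQuiver n) (v : Fin (n + 3)) : Prop := ∃ l ∈ Q.lower, polygonVertex l = v

lemma mem_upper {l : Fin (n + 1)} : l ∈ Q.upper ↔ Q.forward l = true := by simp [upper]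

lemma mem_lower {l : Fin (n + 1)} : l ∈ Q.lower ↔ Q.forward l = false := by simp [lower]

lemma val_polygonVertex (l : Fin (n + 1)) : (polygonVertex l : ℕ) = l + 1 := rfl

lemma polygonVertex_injective : Function.Injective (polygonVertex (n := n)) := fun _ _ h =>
  Fin.succ_injective _ (Fin.castSucc_injective _ h)

lemma isUpper_polygonVertex {l : Fin (n + 1)} :
    Q.IsUpper (polygonVertex l) ↔ Q.forward l = true := by
  simp [IsUpper, polygonVertex_injective.eq_iff, mem_upper]

lemma isLower_polygonVertex {l : Fin (n + 1)} :
    Q.IsLower (polygonVertex l) ↔ Q.forward l = false := by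
  simp [IsLower, polygonVertex_injective.eq_iff, mem_lower]

lemma IsUpper.not_isLower {v : Fin (n + 3)} (h : Q.IsUpper v) : ¬ Q.IsLower v := by
  obtain ⟨l, hl, rfl⟩ := h
  simp [isLower_polygonVertex, mem_upper.1 hl]

/-- The segment `γ` lies below `δ` where the vertical strips over `γ` and `δ` begin to overlap. -/
def StartsBelow (Q : TypeAQuiver n) (γ δ : Segment n) : Prop :=
  γ.1.1 < δ.1.1 ∧ Q.IsUpper δ.1.1 ∨ δ.1.1 < γ.1.1 ∧ Q.IsLower γ.1.1

/-- The segment `γ` lies above `δ` where the vertical strips over `γ` and `δ` cease to overlap. -/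
def EndsAbove (Q : TypeAQuiver n) (γ δ : Segment n) : Prop :=
  γ.1.2 < δ.1.2 ∧ Q.IsUpper γ.1.2 ∨ δ.1.2 < γ.1.2 ∧ Q.IsLower δ.1.2

/-- The vertical strips over `γ` and `δ` overlap. -/
def Overlap (γ δ : Segment n) : Prop := max γ.1.1 δ.1.1 < min γ.1.2 δ.1.2

/-- Read from left to right, `γ` crosses `δ` from below. -/
def CrossesUp (Q : TypeAQuiver n) (γ δ : Segment n) : Prop :=
  Overlap γ δ ∧ Q.StartsBelow γ δ ∧ Q.EndsAbove γ δ

lemma overlap_iff {γ δ : Segment n} : Overlap γ δ ↔ γ.1.1 < δ.1.2 ∧ δ.1.1 < γ.1.2 := by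
  have hγ := γ.2
  have hδ := δ.2
  rw [Overlap, lt_min_iff, max_lt_iff, max_lt_iff]
  tauto

lemma isUpper_or_isLower_of_arrow {x y : Q.Vertex} (α : x ⟶ y) :
    (pos y = pos x + 1 ∧ ∀ v : Fin (n + 3), v.val = pos y → Q.IsUpper v) ∨
      (pos x = pos y + 1 ∧ ∀ v : Fin (n + 3), v.val = pos x → Q.IsLower v) := by
  rcases pos_of_arrow α with ⟨hα, hx, hy⟩ | ⟨hα, hx, hy⟩
  · exact .inl ⟨by rw [hx, hy], fun v hv => ⟨_, mem_upper.2 hα, Fin.ext (hv.trans hy).symm⟩⟩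
  · exact .inr ⟨by rw [hx, hy], fun v hv => ⟨_, mem_lower.2 hα, Fin.ext (hv.trans hx).symm⟩⟩

lemma isEmpty_hom_swap {x y : Q.Vertex} (α : x ⟶ y) : IsEmpty (y ⟶ x) := by
  refine ⟨fun β => ?_⟩
  rcases pos_of_arrow α with ⟨hα, hx, hy⟩ | ⟨hα, hx, hy⟩ <;>
    rcases pos_of_arrow β with ⟨hβ, hy', hx'⟩ | ⟨hβ, hy', hx'⟩
  all_goals first
    | omega
    | exact Bool.false_ne_true <| by rw [← hα, ← hβ]; congr 1; omega

variable {k : Type u} [Field k] {γ δ : Segment n}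

lemma subsingleton_ext_of_not_endsAbove (h : ¬ Q.EndsAbove γ δ) :
    Subsingleton (Ext (segmentRep k Q γ) (segmentRep k Q δ)) := by
  obtain ⟨v, hv⟩ := Q.exists_pos_eq (m := max γ.1.1.val δ.1.1.val - 1) (by omega)
  refine subsingleton_ext_of_common_outer_vertex v fun {x y} α hx hy => ?_
  change (Mem x δ ∨ x = v) ∧ (Mem y γ ∨ y = v)
  rw [EndsAbove, Fin.lt_def, Fin.lt_def] at h
  rw [← pos_injective.eq_iff (a := x), ← pos_injective.eq_iff (a := y)]
  have hx := mem_iff.1 hx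
  have hy := mem_iff.1 hy
  rw [mem_iff, mem_iff]
  rcases isUpper_or_isLower_of_arrow α with ⟨hα, hup⟩ | ⟨hα, hlow⟩
  · have : γ.1.2.val = pos y → δ.1.2.val ≤ γ.1.2.val := fun e =>
      not_lt.1 fun hlt => h (.inl ⟨hlt, hup _ e⟩)
    omega
  · have : δ.1.2.val = pos x → γ.1.2.val ≤ δ.1.2.val := fun e =>
      not_lt.1 fun hlt => h (.inr ⟨hlt, hlow _ e⟩)
    omega

lemma subsingleton_ext_of_not_startsBelow (h : ¬ Q.StartsBelow γ δ) :
    Subsingleton (Ext (segmentRep k Q γ) (segmentRep k Q δ)) := by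
  obtain ⟨v, hv⟩ := Q.exists_pos_eq (m := min (min γ.1.2.val δ.1.2.val) (n + 1)) (by omega)
  refine subsingleton_ext_of_common_outer_vertex v fun {x y} α hx hy => ?_
  change (Mem x δ ∨ x = v) ∧ (Mem y γ ∨ y = v)
  rw [StartsBelow, Fin.lt_def, Fin.lt_def] at h
  rw [← pos_injective.eq_iff (a := x), ← pos_injective.eq_iff (a := y)]
  have hx := mem_iff.1 hx
  have hy := mem_iff.1 hy
  have hx_lt := pos_lt x
  have hy_lt := pos_lt y
  rw [mem_iff, mem_iff]
  rcases isUpper_or_isLower_of_arrow α with ⟨hα, hup⟩ | ⟨hα, hlow⟩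
  · have : δ.1.1.val = pos y → δ.1.1.val ≤ γ.1.1.val := fun e =>
      not_lt.1 fun hlt => h (.inl ⟨hlt, hup _ e⟩)
    omega
  · have : γ.1.1.val = pos x → γ.1.1.val ≤ δ.1.1.val := fun e =>
      not_lt.1 fun hlt => h (.inr ⟨hlt, hlow _ e⟩)
    omega

lemma extCompatible_of_not_overlap (h : ¬ Overlap γ δ) :
    ExtCompatible (segmentRep k Q γ) (segmentRep k Q δ) := by
  rw [overlap_iff, Fin.lt_def, Fin.lt_def] at h
  have := Fin.lt_def.1 γ.2
  have := Fin.lt_def.1 δ.2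
  by_cases arrow : ∃ (x y : Q.Vertex) (_ : x ⟶ y), Mem x γ ∧ Mem y δ
  · obtain ⟨x₀, y₀, α₀, hx₀, hy₀⟩ := arrow
    have hx₀' := mem_iff.1 hx₀
    have hy₀' := mem_iff.1 hy₀
    have adjacent {x y : Q.Vertex} (α : x ⟶ y) : pos y = pos x + 1 ∨ pos x = pos y + 1 :=
      (isUpper_or_isLower_of_arrow α).imp And.left And.left
    have hα₀ := adjacent α₀
    have between_endpoints {x y : Q.Vertex} (α : (x ⟶ y) ⊕ (y ⟶ x)) (hx : Mem x γ) (hy : Mem y δ) :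
        x = x₀ ∧ y = y₀ := by
      have hα := α.elim adjacent fun α => (adjacent α).symm
      rw [mem_iff] at hx hy
      exact ⟨pos_injective (by omega), pos_injective (by omega)⟩
    refine extCompatible_of_unique_arrow (c := min γ.1.1.val δ.1.1.val + 1)
      (d := max γ.1.2.val δ.1.2.val) (fun x hx hx' => ?_) α₀ hx₀ hy₀
      (fun α hx hy => between_endpoints (.inl α) hx hy) (fun x => ?_) fun α hx hy => ?_
    · have := mem_iff.1 hx
      have := mem_iff.1 hx'
      omega
    · rw [between_iff, between_iff, between_iff]
      omega
    · obtain ⟨rfl, rfl⟩ := between_endpoints (.inr α) hy hx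
      exact (isEmpty_hom_swap α₀).false α
  · exact .inl (subsingleton_ext_of_common_outer_vertex (Q.before 0) fun {x y} α hx hy =>
      absurd ⟨x, y, α, hx, hy⟩ arrow)

lemma extCompatible_of_not_crossesUp (h : ¬ Q.CrossesUp γ δ) :
    ExtCompatible (segmentRep k Q γ) (segmentRep k Q δ) := by
  by_cases starts : Q.StartsBelow γ δ
  · by_cases ends : Q.EndsAbove γ δ
    · exact extCompatible_of_not_overlap fun overlap => h ⟨overlap, starts, ends⟩
    · exact .inl (subsingleton_ext_of_not_endsAbove ends)
  · exact .inl (subsingleton_ext_of_not_startsBelow starts)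

lemma StartsBelow.exists_arrow (starts : Q.StartsBelow γ δ) (overlap : Overlap γ δ) :
    ∃ (x y : Q.Vertex) (α : x ⟶ y), polygonVertex (Q.arrowIndex α) = max γ.1.1 δ.1.1 ∧
      Mem x γ ∧ Mem y δ ∧ ¬ (Mem x δ ↔ Mem y γ) := by
  rw [overlap_iff, Fin.lt_def, Fin.lt_def] at overlap
  have := Fin.lt_def.1 γ.2
  have := Fin.lt_def.1 δ.2
  rcases starts with ⟨hlt, l, hl, h⟩ | ⟨hlt, l, hl, h⟩
  · refine ⟨_, _, Q.rightArrow l (mem_upper.1 hl), h.trans (max_eq_right hlt.le).symm, ?_⟩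
    have hv := (val_polygonVertex l).symm.trans (congrArg Fin.val h)
    rw [Fin.lt_def] at hlt
    simp only [mem_iff, pos_before, pos_after]
    omega
  · refine ⟨_, _, Q.leftArrow l (mem_lower.1 hl), h.trans (max_eq_left hlt.le).symm, ?_⟩
    have hv := (val_polygonVertex l).symm.trans (congrArg Fin.val h)
    rw [Fin.lt_def] at hlt
    simp only [mem_iff, pos_before, pos_after]
    omega

lemma EndsAbove.exists_arrow (ends : Q.EndsAbove γ δ) (overlap : Overlap γ δ) :
    ∃ (x y : Q.Vertex) (α : x ⟶ y), polygonVertex (Q.arrowIndex α) = min γ.1.2 δ.1.2 ∧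
      Mem x γ ∧ Mem y δ ∧ ¬ (Mem x δ ↔ Mem y γ) := by
  rw [overlap_iff, Fin.lt_def, Fin.lt_def] at overlap
  have := Fin.lt_def.1 γ.2
  have := Fin.lt_def.1 δ.2
  rcases ends with ⟨hlt, l, hl, h⟩ | ⟨hlt, l, hl, h⟩
  · refine ⟨_, _, Q.rightArrow l (mem_upper.1 hl), h.trans (min_eq_left hlt.le).symm, ?_⟩
    have hv := (val_polygonVertex l).symm.trans (congrArg Fin.val h)
    rw [Fin.lt_def] at hlt
    simp only [mem_iff, pos_before, pos_after]
    omega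
  · refine ⟨_, _, Q.leftArrow l (mem_lower.1 hl), h.trans (min_eq_right hlt.le).symm, ?_⟩
    have hv := (val_polygonVertex l).symm.trans (congrArg Fin.val h)
    rw [Fin.lt_def] at hlt
    simp only [mem_iff, pos_before, pos_after]
    omega

lemma Overlap.exists_mem (Q : TypeAQuiver n) (h : Overlap γ δ) :
    ∃ x : Q.Vertex, Mem x γ ∧ Mem x δ := by
  have hγ := Fin.lt_def.1 γ.2
  have hδ := Fin.lt_def.1 δ.2
  rw [overlap_iff, Fin.lt_def, Fin.lt_def] at h
  obtain ⟨x, hx⟩ := Q.exists_pos_eq (m := max γ.1.1.val δ.1.1.val) (by omega)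
  exact ⟨x, mem_iff.2 (by omega), mem_iff.2 (by omega)⟩

lemma not_extCompatible_of_crossesUp (h : Q.CrossesUp γ δ) :
    ¬ ExtCompatible (segmentRep k Q γ) (segmentRep k Q δ) := by
  obtain ⟨overlap, starts, ends⟩ := h
  rintro (h | ⟨-, E, f, g, ξ, ⟨hfg, -⟩, -, hE⟩)
  · obtain ⟨x₀, y₀, α₀, hα₀, hx₀, hy₀, h₀⟩ := starts.exists_arrow overlap
    obtain ⟨x₁, y₁, α₁, hα₁, hx₁, hy₁, h₁⟩ := ends.exists_arrow overlap
    have index_ne : Q.arrowIndex α₁ ≠ Q.arrowIndex α₀ := fun e =>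
      overlap.ne (by rw [← hα₀, ← hα₁, e])
    exact not_subsingleton_ext_of_two_arrows α₀ α₁ index_ne hx₀ hy₀ h₀ hx₁ hy₁ h₁ h
  · obtain ⟨x, hx, hx'⟩ := overlap.exists_mem Q
    exact not_indecomposable_of_shortExact hfg hx hx' hE

lemma extCompatible_segmentRep_iff :
    ExtCompatible (segmentRep k Q γ) (segmentRep k Q δ) ↔ ¬ Q.CrossesUp γ δ :=
  ⟨fun h h' => not_extCompatible_of_crossesUp h' h, extCompatible_of_not_crossesUp⟩

end TypeAQuiver

/-! ## Paths -/

namespace TypeAQuiver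

variable {n : ℕ} {Q : TypeAQuiver n} {γ δ : Segment n}

/-- The quiver with all arrows reversed. Its polygon is the mirror image of `P(Q)` in the line
`L`, so statements with `above` and `below` exchanged are obtained by passing to it. -/
def opposite (Q : TypeAQuiver n) : TypeAQuiver n := ⟨fun l => !Q.forward l⟩

@[simp]
lemma opposite_opposite : Q.opposite.opposite = Q := by
  simp [opposite]

@[simp]
lemma isUpper_opposite {v : Fin (n + 3)} : Q.opposite.IsUpper v ↔ Q.IsLower v := by
  simp [IsUpper, IsLower, mem_upper, mem_lower, opposite]

@[simp]
lemma isLower_opposite {v : Fin (n + 3)} : Q.opposite.IsLower v ↔ Q.IsUpper v := by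
  simp [IsUpper, IsLower, mem_upper, mem_lower, opposite]

lemma overlap_comm : Overlap γ δ ↔ Overlap δ γ := by
  rw [overlap_iff, overlap_iff, and_comm]

lemma startsBelow_opposite : Q.opposite.StartsBelow γ δ ↔ Q.StartsBelow δ γ := by
  rw [StartsBelow, StartsBelow, isUpper_opposite, isLower_opposite, or_comm]

lemma endsAbove_opposite : Q.opposite.EndsAbove γ δ ↔ Q.EndsAbove δ γ := by
  rw [EndsAbove, EndsAbove, isUpper_opposite, isLower_opposite, or_comm]

lemma crossesUp_opposite : Q.opposite.CrossesUp γ δ ↔ Q.CrossesUp δ γ := by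
  rw [CrossesUp, CrossesUp, overlap_comm, startsBelow_opposite, endsAbove_opposite]

lemma isUpper_or_isLower {v : Fin (n + 3)} (h₀ : v ≠ 0) (h₁ : v ≠ Fin.last (n + 2)) :
    Q.IsUpper v ∨ Q.IsLower v := by
  obtain ⟨w, rfl⟩ := Fin.exists_castSucc_eq.2 h₁
  obtain ⟨l, rfl⟩ := Fin.exists_succ_eq.2 fun h => h₀ (congrArg Fin.castSucc h)
  change Q.IsUpper (polygonVertex l) ∨ Q.IsLower (polygonVertex l)
  rw [isUpper_polygonVertex, isLower_polygonVertex]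
  cases Q.forward l <;> simp

lemma isUpper_or_isLower_of_mem_Ioo {u v w : Fin (n + 3)} (h₀ : u < v) (h₁ : v < w) :
    Q.IsUpper v ∨ Q.IsLower v :=
  isUpper_or_isLower (Fin.ne_zero_of_lt h₀) (Fin.ne_last_of_lt h₁)

/-- The segment `γ` joins two consecutive elements of `V`. -/
def Consecutive (V : Finset (Fin (n + 3))) (γ : Segment n) : Prop :=
  γ.1.1 ∈ V ∧ γ.1.2 ∈ V ∧ ∀ c ∈ V, ¬ (γ.1.1 < c ∧ c < γ.1.2)

/-- The path through the elements of `V` passes below `γ` near the vertex `v`: it misses the upper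
end point `v` of `γ`, or it visits the lower vertex `v` between the end points of `γ`. -/
def PathBelow (Q : TypeAQuiver n) (V : Finset (Fin (n + 3))) (γ : Segment n) (v : Fin (n + 3)) :
    Prop :=
  (v = γ.1.1 ∨ v = γ.1.2) ∧ Q.IsUpper v ∧ v ∉ V ∨ (γ.1.1 < v ∧ v < γ.1.2) ∧ Q.IsLower v ∧ v ∈ V

/-- The path through the elements of `V` passes above `γ` near the vertex `v`. -/
def PathAbove (Q : TypeAQuiver n) (V : Finset (Fin (n + 3))) (γ : Segment n) (v : Fin (n + 3)) :
    Prop :=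
  Q.opposite.PathBelow V γ v

lemma pathAbove_iff {V : Finset (Fin (n + 3))} {v : Fin (n + 3)} :
    Q.PathAbove V γ v ↔ (v = γ.1.1 ∨ v = γ.1.2) ∧ Q.IsLower v ∧ v ∉ V ∨
      (γ.1.1 < v ∧ v < γ.1.2) ∧ Q.IsUpper v ∧ v ∈ V := by
  rw [PathAbove, PathBelow, isUpper_opposite, isLower_opposite]

lemma PathBelow.ne {V W : Finset (Fin (n + 3))} {a b : Fin (n + 3)} (ha : Q.PathBelow V γ a)
    (hb : Q.PathAbove W γ b) : a ≠ b := by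
  rintro rfl
  rcases ha with ⟨ha, hup, -⟩ | ⟨ha, hlow, -⟩ <;>
    rcases pathAbove_iff.1 hb with ⟨hb, hlow', -⟩ | ⟨hb, hup', -⟩
  · exact hup.not_isLower hlow'
  · exact ha.elim hb.1.ne' hb.2.ne
  · exact hb.elim ha.1.ne' ha.2.ne
  · exact hup'.not_isLower hlow

lemma PathBelow.left_le {V : Finset (Fin (n + 3))} {v : Fin (n + 3)} (h : Q.PathBelow V γ v) :
    γ.1.1 ≤ v := by
  rcases h with ⟨rfl | rfl, -⟩ | ⟨⟨h, -⟩, -⟩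
  exacts [le_rfl, γ.2.le, h.le]

lemma PathBelow.le_right {V : Finset (Fin (n + 3))} {v : Fin (n + 3)} (h : Q.PathBelow V γ v) :
    v ≤ γ.1.2 := by
  rcases h with ⟨rfl | rfl, -⟩ | ⟨⟨-, h⟩, -⟩
  exacts [γ.2.le, le_rfl, h.le]

lemma PathBelow.congr {V W : Finset (Fin (n + 3))} {v : Fin (n + 3)} (h : Q.PathBelow V γ v)
    (hVW : v ∈ V ↔ v ∈ W) : Q.PathBelow W γ v := by
  rwa [PathBelow, ← hVW]

section Path

variable {V : Finset (Fin (n + 3))} (h₀ : 0 ∈ V) (h₁ : Fin.last (n + 2) ∈ V)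

include h₀ h₁

lemma consecutive_of_not_pathBelow_of_not_pathAbove (below : ∀ v, ¬ Q.PathBelow V γ v)
    (above : ∀ v, ¬ Q.PathAbove V γ v) : Consecutive V γ := by
  have mem_of_endpoint (v : Fin (n + 3)) (hv : v = γ.1.1 ∨ v = γ.1.2) : v ∈ V := by
    by_contra hvV
    rcases isUpper_or_isLower (Q := Q) (v := v) (fun h => hvV (h ▸ h₀)) (fun h => hvV (h ▸ h₁))
      with hup | hlow
    · exact below v (.inl ⟨hv, hup, hvV⟩)
    · exact above v (pathAbove_iff.2 (.inl ⟨hv, hlow, hvV⟩))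
  refine ⟨mem_of_endpoint _ (.inl rfl), mem_of_endpoint _ (.inr rfl), fun c hcV hc => ?_⟩
  rcases isUpper_or_isLower_of_mem_Ioo (Q := Q) hc.1 hc.2 with hup | hlow
  · exact above c (pathAbove_iff.2 (.inr ⟨hc, hup, hcV⟩))
  · exact below c (.inr ⟨hc, hlow, hcV⟩)

lemma exists_consecutive_around {a b : Fin (n + 3)} (hab : a < b)
    (hV : ∀ c ∈ V, ¬ (a < c ∧ c < b)) :
    ∃ δ : Segment n, Consecutive V δ ∧ δ.1.1 ≤ a ∧ b ≤ δ.1.2 := by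
  obtain ⟨p, hp, hp_max⟩ := (V.filter (· ≤ a)).exists_max_image id
    ⟨0, Finset.mem_filter.2 ⟨h₀, Fin.zero_le _⟩⟩
  obtain ⟨q, hq, hq_min⟩ := (V.filter (b ≤ ·)).exists_min_image id
    ⟨Fin.last _, Finset.mem_filter.2 ⟨h₁, Fin.le_last _⟩⟩
  simp only [Finset.mem_filter, id, and_imp] at hp hp_max hq hq_min
  refine ⟨⟨(p, q), hp.2.trans_lt (hab.trans_le hq.2)⟩, ⟨hp.1, hq.1, fun c hc ⟨hpc, hcq⟩ => ?_⟩,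
    hp.2, hq.2⟩
  exact hV c hc ⟨lt_of_not_ge fun h => (hp_max c hc h).not_gt hpc,
    lt_of_not_ge fun h => (hq_min c hc h).not_gt hcq⟩

omit h₀ h₁ in
lemma PathBelow.startsBelow {a : Fin (n + 3)} (h : Q.PathBelow V γ a) (hδ : Consecutive V δ)
    (hδa : δ.1.1 ≤ a) (haδ : a < δ.1.2) (haγ : a < γ.1.2) : Q.StartsBelow δ γ := by
  rcases h with ⟨rfl | rfl, hup, haV⟩ | ⟨⟨hγa, -⟩, hlow, haV⟩
  · exact .inl ⟨hδa.lt_of_ne fun h => haV (h ▸ hδ.1), hup⟩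
  · exact absurd haγ (lt_irrefl _)
  · obtain rfl := hδa.eq_of_not_lt fun h => hδ.2.2 a haV ⟨h, haδ⟩
    exact .inr ⟨hγa, hlow⟩

omit h₀ h₁ in
lemma PathAbove.endsAbove {b : Fin (n + 3)} (h : Q.PathAbove V γ b) (hδ : Consecutive V δ)
    (hδb : δ.1.1 < b) (hbδ : b ≤ δ.1.2) (hγb : γ.1.1 < b) : Q.EndsAbove δ γ := by
  rcases pathAbove_iff.1 h with ⟨rfl | rfl, hlow, hbV⟩ | ⟨⟨-, hbγ⟩, hup, hbV⟩
  · exact absurd hγb (lt_irrefl _)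
  · exact .inr ⟨hbδ.lt_of_ne fun h => hbV (h ▸ hδ.2.1), hlow⟩
  · obtain rfl := hbδ.eq_of_not_lt fun h => hδ.2.2 b hbV ⟨hδb, h⟩
    exact .inl ⟨hbγ, hup⟩

/-- Between the last vertex before `b` at which the path is below `γ` and the next vertex at which
it is above `γ`, the path has no vertices; hence the crossing is on a single segment. -/
lemma exists_crossesUp_of_pathBelow_of_pathAbove {a b : Fin (n + 3)} (hab : a < b)
    (ha : Q.PathBelow V γ a) (hb : Q.PathAbove V γ b) :
    ∃ δ, Consecutive V δ ∧ Q.CrossesUp δ γ := by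
  classical
  obtain ⟨a', ha', ha'_max⟩ := Finset.exists_max_image
    (Finset.univ.filter fun c => Q.PathBelow V γ c ∧ c < b) id ⟨a, by simp [ha, hab]⟩
  simp only [Finset.mem_filter, Finset.mem_univ, true_and, id, and_imp] at ha' ha'_max
  obtain ⟨b', hb', hb'_min⟩ := Finset.exists_min_image
    (Finset.univ.filter fun c => Q.PathAbove V γ c ∧ a' < c) id ⟨b, by simp [hb, ha'.2]⟩
  simp only [Finset.mem_filter, Finset.mem_univ, true_and, id, and_imp] at hb' hb'_min
  have hγa := ha'.1.left_le
  have hbγ : b' ≤ γ.1.2 := PathBelow.le_right hb'.1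
  obtain ⟨δ, hδ, hδa, hbδ⟩ := exists_consecutive_around h₀ h₁ hb'.2 fun c hcV ⟨hac, hcb⟩ => by
    have hγc := hγa.trans_lt hac
    have hcγ := hcb.trans_le hbγ
    rcases isUpper_or_isLower_of_mem_Ioo (Q := Q) hac hcb with hup | hlow
    · exact (hb'_min c (pathAbove_iff.2 (.inr ⟨⟨hγc, hcγ⟩, hup, hcV⟩)) hac).not_gt hcb
    · exact (ha'_max c (.inr ⟨⟨hγc, hcγ⟩, hlow, hcV⟩)
        (hcb.trans_le (hb'_min b hb ha'.2))).not_gt hac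
  exact ⟨δ, hδ,
    overlap_iff.2 ⟨hδa.trans_lt (hb'.2.trans_le hbγ), hγa.trans_lt (hb'.2.trans_le hbδ)⟩,
    ha'.1.startsBelow hδ hδa (hb'.2.trans_le hbδ) (hb'.2.trans_le hbγ),
    hb'.1.endsAbove hδ (hδa.trans_lt hb'.2) hbδ (hγa.trans_lt hb'.2)⟩

lemma exists_crossing_of_pathBelow_of_pathAbove {a b : Fin (n + 3)}
    (ha : Q.PathBelow V γ a) (hb : Q.PathAbove V γ b) :
    ∃ δ, Consecutive V δ ∧ (Q.CrossesUp γ δ ∨ Q.CrossesUp δ γ) := by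
  rcases (ha.ne hb).lt_or_gt with hab | hba
  · obtain ⟨δ, hδ, h⟩ := exists_crossesUp_of_pathBelow_of_pathAbove h₀ h₁ hab ha hb
    exact ⟨δ, hδ, .inr h⟩
  · obtain ⟨δ, hδ, h⟩ := exists_crossesUp_of_pathBelow_of_pathAbove (Q := Q.opposite) h₀ h₁ hba hb
      (by rwa [PathAbove, opposite_opposite])
    exact ⟨δ, hδ, .inl (crossesUp_opposite.1 h)⟩

end Path

variable {π : Equiv.Perm (Fin (n + 1))}

lemma mem_pathSupport_succ {i l : Fin (n + 1)} (hl : l ≠ π i) :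
    l ∈ Q.pathSupport π i.succ ↔ l ∈ Q.pathSupport π i.castSucc := by
  simp only [pathSupport, Fin.induction_succ]
  split_ifs
  · rw [Finset.mem_insert, or_iff_right hl]
  · rw [Finset.mem_erase, and_iff_right hl]

lemma mem_pathSupport {t : Fin (n + 2)} {l : Fin (n + 1)} :
    l ∈ Q.pathSupport π t ↔ (l ∈ Q.upper ↔ (π.symm l).castSucc < t) := by
  induction t using Fin.induction with
  | zero =>
    change l ∈ Q.lower ↔ _
    simp [mem_lower, mem_upper]
  | succ i ih =>
    rw [Fin.castSucc_lt_succ_iff]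
    by_cases hl : l = π i
    · subst hl
      rw [pathSupport, Fin.induction_succ]
      by_cases h : π i ∈ Q.upper <;> simp [h]
    · have lt_iff_le : (π.symm l).castSucc < i.castSucc ↔ π.symm l ≤ i := by
        rw [Fin.castSucc_lt_castSucc_iff, lt_iff_le_and_ne, Ne, Equiv.symm_apply_eq]
        exact and_iff_left hl
      rw [← lt_iff_le, ← ih, mem_pathSupport_succ hl]

lemma mem_identityArrows {t : Fin (n + 2)} {l : Fin (n + 1)} :
    l ∈ Q.identityArrows π t ↔ l ∉ Q.pathSupport π t := by
  suffices h : Q.identityArrows π t = (Q.pathSupport π t)ᶜ by rw [h, Finset.mem_compl]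
  induction t using Fin.induction with
  | zero => rfl
  | succ i ih =>
    rw [identityArrows, pathSupport] at ih ⊢
    rw [Fin.induction_succ, Fin.induction_succ, ih]
    split_ifs
    · rw [Finset.compl_insert]
    · rw [Finset.compl_erase]

lemma polygonVertex_ne_zero (l : Fin (n + 1)) : polygonVertex l ≠ 0 :=
  Fin.castSucc_ne_zero_iff.2 (Fin.succ_ne_zero l)

lemma polygonVertex_ne_last (l : Fin (n + 1)) : polygonVertex l ≠ Fin.last (n + 2) :=
  Fin.castSucc_ne_last _

lemma zero_mem_pathVertices (t : Fin (n + 2)) : 0 ∈ Q.pathVertices π t := by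
  simp [pathVertices]

lemma last_mem_pathVertices (t : Fin (n + 2)) : Fin.last (n + 2) ∈ Q.pathVertices π t := by
  simp [pathVertices]

lemma polygonVertex_mem_pathVertices {t : Fin (n + 2)} {l : Fin (n + 1)} :
    polygonVertex l ∈ Q.pathVertices π t ↔ l ∈ Q.pathSupport π t := by
  simp [pathVertices, polygonVertex_ne_zero, polygonVertex_ne_last,
    polygonVertex_injective.eq_iff]

lemma mem_pathVertices_succ {i : Fin (n + 1)} {v : Fin (n + 3)} (hv : v ≠ polygonVertex (π i)) :
    v ∈ Q.pathVertices π i.succ ↔ v ∈ Q.pathVertices π i.castSucc := by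
  simp only [pathVertices, Finset.mem_union, Finset.mem_image]
  refine or_congr_right (exists_congr fun l => and_congr_left ?_)
  rintro rfl
  exact mem_pathSupport_succ fun h => hv (congrArg polygonVertex h)

lemma mem_path {t : Fin (n + 2)} : γ ∈ Q.path π t ↔ Consecutive (Q.pathVertices π t) γ := by
  simp [path, Consecutive]

lemma mem_eta : γ ∈ Q.eta π ↔ ∃ t, Consecutive (Q.pathVertices π t) γ := by
  simp [eta, mem_path]

lemma IsUpper.mem_pathVertices_iff {t : Fin (n + 2)} {l : Fin (n + 1)}
    (h : Q.IsUpper (polygonVertex l)) :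
    polygonVertex l ∈ Q.pathVertices π t ↔ (π.symm l).castSucc < t := by
  rw [polygonVertex_mem_pathVertices, mem_pathSupport, mem_upper, ← isUpper_polygonVertex,
    iff_true_left h]

lemma IsLower.mem_pathVertices_iff {t : Fin (n + 2)} {l : Fin (n + 1)}
    (h : Q.IsLower (polygonVertex l)) :
    polygonVertex l ∈ Q.pathVertices π t ↔ t ≤ (π.symm l).castSucc := by
  rw [polygonVertex_mem_pathVertices, mem_pathSupport, mem_upper, ← isUpper_polygonVertex,
    iff_false_left fun h' : Q.IsUpper _ => h'.not_isLower h, not_lt]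

lemma IsUpper.mem_pathVertices_of_le {s t : Fin (n + 2)} (hst : s ≤ t) {v : Fin (n + 3)}
    (hv : Q.IsUpper v) (h : v ∈ Q.pathVertices π s) : v ∈ Q.pathVertices π t := by
  obtain ⟨l, -, rfl⟩ := id hv
  exact hv.mem_pathVertices_iff.2 ((hv.mem_pathVertices_iff.1 h).trans_le hst)

lemma IsLower.mem_pathVertices_of_le {s t : Fin (n + 2)} (hst : s ≤ t) {v : Fin (n + 3)}
    (hv : Q.IsLower v) (h : v ∈ Q.pathVertices π t) : v ∈ Q.pathVertices π s := by
  obtain ⟨l, -, rfl⟩ := id hv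
  exact hv.mem_pathVertices_iff.2 (hst.trans (hv.mem_pathVertices_iff.1 h))

lemma not_crossesUp_of_mem_paths {s t : Fin (n + 2)} (hst : s ≤ t)
    (hγ : Consecutive (Q.pathVertices π s) γ) (hδ : Consecutive (Q.pathVertices π t) δ) :
    ¬ Q.CrossesUp γ δ ∧ ¬ Q.CrossesUp δ γ := by
  obtain ⟨hγ₁, hγ₂, hγ⟩ := hγ
  obtain ⟨hδ₁, hδ₂, hδ⟩ := hδ
  constructor <;> rintro ⟨overlap, starts, ends⟩ <;> rw [overlap_iff] at overlap
  · rcases ends with ⟨hlt, hup⟩ | ⟨hlt, hlow⟩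
    · exact hδ _ (hup.mem_pathVertices_of_le hst hγ₂) ⟨overlap.2, hlt⟩
    · exact hγ _ (hlow.mem_pathVertices_of_le hst hδ₂) ⟨overlap.1, hlt⟩
  · rcases starts with ⟨hlt, hup⟩ | ⟨hlt, hlow⟩
    · exact hδ _ (hup.mem_pathVertices_of_le hst hγ₁) ⟨hlt, overlap.2⟩
    · exact hγ _ (hlow.mem_pathVertices_of_le hst hδ₁) ⟨hlt, overlap.1⟩

lemma not_crossesUp_of_mem_eta (hγ : γ ∈ Q.eta π) (hδ : δ ∈ Q.eta π) : ¬ Q.CrossesUp γ δ := by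
  obtain ⟨s, hγ⟩ := mem_eta.1 hγ
  obtain ⟨t, hδ⟩ := mem_eta.1 hδ
  rcases le_total s t with h | h
  · exact (not_crossesUp_of_mem_paths h hγ hδ).1
  · exact (not_crossesUp_of_mem_paths h hδ hγ).2

lemma not_pathAbove_pathVertices_zero (v : Fin (n + 3)) :
    ¬ Q.PathAbove (Q.pathVertices π 0) γ v := by
  rw [pathAbove_iff]
  rintro (⟨-, hv, hmem⟩ | ⟨-, hv, hmem⟩) <;> obtain ⟨l, -, rfl⟩ := id hv
  · exact hmem (hv.mem_pathVertices_iff.2 (Fin.zero_le _))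
  · exact Fin.not_lt_zero _ (hv.mem_pathVertices_iff.1 hmem)

lemma not_pathBelow_pathVertices_last (v : Fin (n + 3)) :
    ¬ Q.PathBelow (Q.pathVertices π (Fin.last (n + 1))) γ v := by
  rintro (⟨-, hv, hmem⟩ | ⟨-, hv, hmem⟩) <;> obtain ⟨l, -, rfl⟩ := id hv
  · exact hmem (hv.mem_pathVertices_iff.2 (Fin.castSucc_lt_last _))
  · exact (hv.mem_pathVertices_iff.1 hmem).not_gt (Fin.castSucc_lt_last _)

/-- If `γ` is crossed by none of the paths, each path either contains `γ` or lies on one side of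
it. The first is not above and the last not below `γ`, and no step can jump over `γ` because it
changes the path at one vertex only. -/
lemma mem_eta_of_forall_not_crossesUp
    (h : ∀ δ ∈ Q.eta π, ¬ Q.CrossesUp γ δ ∧ ¬ Q.CrossesUp δ γ) : γ ∈ Q.eta π := by
  by_contra hγ
  have not_above {t : Fin (n + 2)} {a b : Fin (n + 3)}
      (ha : Q.PathBelow (Q.pathVertices π t) γ a) : ¬ Q.PathAbove (Q.pathVertices π t) γ b := by
    intro hb
    obtain ⟨δ, hδ, hcross⟩ := exists_crossing_of_pathBelow_of_pathAbove
      (zero_mem_pathVertices t) (last_mem_pathVertices t) ha hb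
    exact not_or.2 (h δ (mem_eta.2 ⟨t, hδ⟩)) hcross
  have below_or_above (t : Fin (n + 2)) : (∃ a, Q.PathBelow (Q.pathVertices π t) γ a) ∨
      ∃ b, Q.PathAbove (Q.pathVertices π t) γ b := by
    by_contra! hnone
    exact hγ (mem_eta.2 ⟨t, consecutive_of_not_pathBelow_of_not_pathAbove
      (zero_mem_pathVertices t) (last_mem_pathVertices t) hnone.1 hnone.2⟩)
  have exists_below (t : Fin (n + 2)) : ∃ a, Q.PathBelow (Q.pathVertices π t) γ a := by
    induction t using Fin.induction with
    | zero =>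
      exact (below_or_above 0).resolve_right fun ⟨b, hb⟩ => not_pathAbove_pathVertices_zero b hb
    | succ i ih =>
      by_contra hnot
      obtain ⟨a, ha⟩ := ih
      obtain ⟨b, hb⟩ := (below_or_above i.succ).resolve_left hnot
      have ha_eq : a = polygonVertex (π i) := by_contra fun hne =>
        hnot ⟨a, ha.congr (mem_pathVertices_succ hne).symm⟩
      have hb_eq : b = polygonVertex (π i) := by_contra fun hne =>
        not_above ha (PathBelow.congr hb (mem_pathVertices_succ hne))
      exact ha.ne hb (ha_eq.trans hb_eq.symm)
  obtain ⟨a, ha⟩ := exists_below (Fin.last (n + 1))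
  exact not_pathBelow_pathVertices_last a ha

end TypeAQuiver

/-! ## Segments in the plane -/

/-- The height at `x` of the line through `p` and `q`. -/
noncomputable def lineHeight (p q : ℝ × ℝ) (x : ℝ) : ℝ :=
  p.2 + (q.2 - p.2) / (q.1 - p.1) * (x - p.1)

lemma lineHeight_left (p q : ℝ × ℝ) : lineHeight p q p.1 = p.2 := by
  simp [lineHeight]

lemma lineHeight_right {p q : ℝ × ℝ} (h : p.1 < q.1) : lineHeight p q q.1 = q.2 := by
  rw [lineHeight, div_mul_cancel₀ _ (sub_pos.2 h).ne', add_sub_cancel]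

lemma lineHeight_add (p q : ℝ × ℝ) {s t : ℝ} (h : s + t = 1) (x y : ℝ) :
    lineHeight p q (s * x + t * y) = s * lineHeight p q x + t * lineHeight p q y := by
  obtain rfl := eq_sub_of_add_eq h
  simp only [lineHeight]
  ring

lemma continuous_lineHeight (p q : ℝ × ℝ) : Continuous (lineHeight p q) := by
  unfold lineHeight
  fun_prop

lemma mem_openSegment_iff_lineHeight {p q r : ℝ × ℝ} (h : p.1 < q.1) :
    r ∈ openSegment ℝ p q ↔ r.1 ∈ Set.Ioo p.1 q.1 ∧ lineHeight p q r.1 = r.2 := by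
  have lineHeight_eq {s t : ℝ} (hst : s + t = 1) :
      lineHeight p q (s * p.1 + t * q.1) = s * p.2 + t * q.2 := by
    rw [lineHeight_add p q hst, lineHeight_left, lineHeight_right h]
  rw [← openSegment_eq_Ioo h]
  constructor
  · rintro ⟨s, t, hs, ht, hst, rfl⟩
    exact ⟨⟨s, t, hs, ht, hst, rfl⟩, lineHeight_eq hst⟩
  · rintro ⟨⟨s, t, hs, ht, hst, hx⟩, hr⟩
    refine ⟨s, t, hs, ht, hst, Prod.ext hx ?_⟩
    rw [← hr, ← hx]
    exact (lineHeight_eq hst).symm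

namespace TypeAQuiver

variable {n : ℕ} {Q : TypeAQuiver n} {γ δ : Segment n}

lemma Overlap.eq_or_startsBelow (h : Overlap γ δ) :
    γ.1.1 = δ.1.1 ∨ Q.StartsBelow γ δ ∨ Q.StartsBelow δ γ := by
  rw [overlap_iff] at h
  rcases lt_trichotomy γ.1.1 δ.1.1 with hlt | heq | hlt
  · rcases isUpper_or_isLower_of_mem_Ioo (Q := Q) hlt h.2 with hup | hlow
    exacts [.inr (.inl (.inl ⟨hlt, hup⟩)), .inr (.inr (.inr ⟨hlt, hlow⟩))]
  · exact .inl heq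
  · rcases isUpper_or_isLower_of_mem_Ioo (Q := Q) hlt h.1 with hup | hlow
    exacts [.inr (.inr (.inl ⟨hlt, hup⟩)), .inr (.inl (.inr ⟨hlt, hlow⟩))]

lemma Overlap.eq_or_endsAbove (h : Overlap γ δ) :
    γ.1.2 = δ.1.2 ∨ Q.EndsAbove γ δ ∨ Q.EndsAbove δ γ := by
  rw [overlap_iff] at h
  rcases lt_trichotomy γ.1.2 δ.1.2 with hlt | heq | hlt
  · rcases isUpper_or_isLower_of_mem_Ioo (Q := Q) h.2 hlt with hup | hlow
    exacts [.inr (.inl (.inl ⟨hlt, hup⟩)), .inr (.inr (.inr ⟨hlt, hlow⟩))]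
  · exact .inl heq
  · rcases isUpper_or_isLower_of_mem_Ioo (Q := Q) h.1 hlt with hup | hlow
    exacts [.inr (.inr (.inl ⟨hlt, hup⟩)), .inr (.inl (.inr ⟨hlt, hlow⟩))]

namespace Polygon

variable (P : Q.Polygon)

/-- The height at `x` of the line through the end points of `γ`. -/
noncomputable def height (γ : Segment n) : ℝ → ℝ := lineHeight (P.pt γ.1.1) (P.pt γ.1.2)

lemma fst_lt_iff {u v : Fin (n + 3)} : (P.pt u).1 < (P.pt v).1 ↔ u < v :=
  P.left_to_right.lt_iff_lt

lemma height_left (γ : Segment n) : P.height γ (P.pt γ.1.1).1 = (P.pt γ.1.1).2 :=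
  lineHeight_left _ _

lemma height_right (γ : Segment n) : P.height γ (P.pt γ.1.2).1 = (P.pt γ.1.2).2 :=
  lineHeight_right (P.fst_lt_iff.2 γ.2)

lemma height_add (γ : Segment n) {s t : ℝ} (h : s + t = 1) (x y : ℝ) :
    P.height γ (s * x + t * y) = s * P.height γ x + t * P.height γ y :=
  lineHeight_add _ _ h x y

lemma mem_openSegment_iff {r : ℝ × ℝ} : r ∈ openSegment ℝ (P.pt γ.1.1) (P.pt γ.1.2) ↔
    r.1 ∈ Set.Ioo (P.pt γ.1.1).1 (P.pt γ.1.2).1 ∧ P.height γ r.1 = r.2 :=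
  mem_openSegment_iff_lineHeight (P.fst_lt_iff.2 γ.2)

lemma mk_lineHeight_mem_convexHull {S : Set (Fin (n + 3))} {u v w : Fin (n + 3)} (hu : u ∈ S)
    (hw : w ∈ S) (huv : u < v) (hvw : v < w) :
    ((P.pt v).1, lineHeight (P.pt u) (P.pt w) (P.pt v).1) ∈ convexHull ℝ (P.pt '' S) := by
  have mem_openSegment : ((P.pt v).1, lineHeight (P.pt u) (P.pt w) (P.pt v).1) ∈
      openSegment ℝ (P.pt u) (P.pt w) :=
    (mem_openSegment_iff_lineHeight (P.fst_lt_iff.2 (huv.trans hvw))).2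
      ⟨⟨P.fst_lt_iff.2 huv, P.fst_lt_iff.2 hvw⟩, rfl⟩
  exact (convex_convexHull ℝ _).openSegment_subset
    (subset_convexHull ℝ _ (Set.mem_image_of_mem _ hu))
    (subset_convexHull ℝ _ (Set.mem_image_of_mem _ hw)) mem_openSegment

/-- The vertical segment from the line `L` to `γ` is contained in the convex hull of the end points
of `L` and `γ`, hence contains no other vertex. -/
lemma snd_notMem_segment_height {v : Fin (n + 3)} (h₁ : γ.1.1 < v) (h₂ : v < γ.1.2) :
    (P.pt v).2 ∉ segment ℝ (P.pt 0).2 (P.height γ (P.pt v).1) := by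
  intro hv
  have h₀ : 0 < v := (Fin.zero_le _).trans_lt h₁
  have h_last : v < Fin.last (n + 2) := h₂.trans_le (Fin.le_last _)
  have lineHeight_eq :
      lineHeight (P.pt 0) (P.pt (Fin.last (n + 2))) (P.pt v).1 = (P.pt 0).2 := by
    simp [lineHeight, P.horizontal]
  rw [← lineHeight_eq] at hv
  have mem_segment : P.pt v ∈ segment ℝ
      ((P.pt v).1, lineHeight (P.pt 0) (P.pt (Fin.last (n + 2))) (P.pt v).1)
      ((P.pt v).1, P.height γ (P.pt v).1) := by
    rw [← Prod.image_mk_segment_right]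
    exact Set.mem_image_of_mem _ hv
  have mem_convexHull : P.pt v ∈
      convexHull ℝ (P.pt '' {0, Fin.last (n + 2), γ.1.1, γ.1.2}) :=
    (convex_convexHull ℝ _).segment_subset
      (P.mk_lineHeight_mem_convexHull (by simp) (by simp) h₀ h_last)
      (P.mk_lineHeight_mem_convexHull (by simp) (by simp) h₁ h₂)
      mem_segment
  rcases P.convex _ v mem_convexHull with h | h | h | h
  exacts [h₀.ne' h, h_last.ne h, h₁.ne' h, h₂.ne h]

lemma height_lt {v : Fin (n + 3)} (h₁ : γ.1.1 < v) (h₂ : v < γ.1.2) (hv : Q.IsUpper v) :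
    P.height γ (P.pt v).1 < (P.pt v).2 := by
  obtain ⟨l, hl, rfl⟩ := hv
  by_contra! hle
  apply P.snd_notMem_segment_height h₁ h₂
  rw [segment_eq_Icc ((P.above l hl).le.trans hle)]
  exact ⟨(P.above l hl).le, hle⟩

lemma lt_height {v : Fin (n + 3)} (h₁ : γ.1.1 < v) (h₂ : v < γ.1.2) (hv : Q.IsLower v) :
    (P.pt v).2 < P.height γ (P.pt v).1 := by
  obtain ⟨l, hl, rfl⟩ := hv
  by_contra! hle
  apply P.snd_notMem_segment_height h₁ h₂
  rw [segment_symm, segment_eq_Icc (hle.trans (P.below l hl).le)]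
  exact ⟨hle, (P.below l hl).le⟩

lemma height_left_lt (h : Overlap γ δ) (hs : Q.StartsBelow γ δ) :
    P.height γ (P.pt (max γ.1.1 δ.1.1)).1 < P.height δ (P.pt (max γ.1.1 δ.1.1)).1 := by
  rw [overlap_iff] at h
  rcases hs with ⟨hlt, hv⟩ | ⟨hlt, hv⟩
  · rw [max_eq_right hlt.le, height_left]
    exact P.height_lt hlt h.2 hv
  · rw [max_eq_left hlt.le, height_left]
    exact P.lt_height hlt h.1 hv

lemma height_right_lt (h : Overlap γ δ) (he : Q.EndsAbove γ δ) :
    P.height δ (P.pt (min γ.1.2 δ.1.2)).1 < P.height γ (P.pt (min γ.1.2 δ.1.2)).1 := by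
  rw [overlap_iff] at h
  rcases he with ⟨hlt, hv⟩ | ⟨hlt, hv⟩
  · rw [min_eq_left hlt.le, height_right]
    exact P.height_lt h.2 hlt hv
  · rw [min_eq_right hlt.le, height_right]
    exact P.lt_height h.1 hlt hv

lemma not_nonCrossing_iff : ¬ P.NonCrossing γ δ ↔
    ∃ x ∈ Set.Ioo (P.pt (max γ.1.1 δ.1.1)).1 (P.pt (min γ.1.2 δ.1.2)).1,
      P.height γ x = P.height δ x := by
  have mem_Ioo_iff (x : ℝ) : x ∈ Set.Ioo (P.pt (max γ.1.1 δ.1.1)).1 (P.pt (min γ.1.2 δ.1.2)).1 ↔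
      x ∈ Set.Ioo (P.pt γ.1.1).1 (P.pt γ.1.2).1 ∧ x ∈ Set.Ioo (P.pt δ.1.1).1 (P.pt δ.1.2).1 := by
    rw [← Set.mem_inter_iff, Set.Ioo_inter_Ioo, P.left_to_right.monotone.map_max,
      P.left_to_right.monotone.map_min]
  simp only [mem_Ioo_iff]
  rw [NonCrossing, Set.not_disjoint_iff]
  simp only [P.mem_openSegment_iff]
  constructor
  · rintro ⟨r, ⟨hγ, hγr⟩, hδ, hδr⟩
    exact ⟨r.1, ⟨hγ, hδ⟩, hγr.trans hδr.symm⟩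
  · rintro ⟨x, ⟨hγ, hδ⟩, hx⟩
    exact ⟨(x, P.height γ x), ⟨hγ, rfl⟩, hδ, hx.symm⟩

lemma not_nonCrossing_of_crossesUp (h : Q.CrossesUp γ δ) : ¬ P.NonCrossing γ δ := by
  obtain ⟨overlap, starts, ends⟩ := h
  obtain ⟨x, hx, h_zero⟩ := intermediate_value_Ioo (P.fst_lt_iff.2 overlap).le
    ((continuous_lineHeight _ _).sub (continuous_lineHeight _ _)).continuousOn
    ⟨sub_neg.2 (P.height_left_lt overlap starts), sub_pos.2 (P.height_right_lt overlap ends)⟩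
  exact P.not_nonCrossing_iff.2 ⟨x, hx, sub_eq_zero.1 h_zero⟩

lemma height_left_eq_or_lt (h : Overlap γ δ) :
    γ.1.1 = δ.1.1 ∧ P.height γ (P.pt (max γ.1.1 δ.1.1)).1 = P.height δ (P.pt (max γ.1.1 δ.1.1)).1 ∨
    Q.StartsBelow γ δ ∧
      P.height γ (P.pt (max γ.1.1 δ.1.1)).1 < P.height δ (P.pt (max γ.1.1 δ.1.1)).1 ∨
    Q.StartsBelow δ γ ∧
      P.height δ (P.pt (max γ.1.1 δ.1.1)).1 < P.height γ (P.pt (max γ.1.1 δ.1.1)).1 := by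
  refine h.eq_or_startsBelow.imp (fun heq => ⟨heq, ?_⟩)
    (.imp (fun hs => ⟨hs, P.height_left_lt h hs⟩) fun hs => ⟨hs, ?_⟩)
  · rw [heq, max_self, P.height_left δ, ← heq, P.height_left γ]
  · rw [max_comm]
    exact P.height_left_lt (overlap_comm.1 h) hs

lemma height_right_eq_or_lt (h : Overlap γ δ) :
    γ.1.2 = δ.1.2 ∧ P.height γ (P.pt (min γ.1.2 δ.1.2)).1 = P.height δ (P.pt (min γ.1.2 δ.1.2)).1 ∨
    Q.EndsAbove γ δ ∧
      P.height δ (P.pt (min γ.1.2 δ.1.2)).1 < P.height γ (P.pt (min γ.1.2 δ.1.2)).1 ∨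
    Q.EndsAbove δ γ ∧
      P.height γ (P.pt (min γ.1.2 δ.1.2)).1 < P.height δ (P.pt (min γ.1.2 δ.1.2)).1 := by
  refine h.eq_or_endsAbove.imp (fun heq => ⟨heq, ?_⟩)
    (.imp (fun he => ⟨he, P.height_right_lt h he⟩) fun he => ⟨he, ?_⟩)
  · rw [heq, min_self, P.height_right δ, ← heq, P.height_right γ]
  · rw [min_comm]
    exact P.height_right_lt (overlap_comm.1 h) he

/-- The difference of the heights is an affine function, so a zero inside the overlap forces its
values at the two ends to have opposite signs or to vanish. -/
lemma nonCrossing_of_not_crossesUp (hne : γ ≠ δ) (hγδ : ¬ Q.CrossesUp γ δ)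
    (hδγ : ¬ Q.CrossesUp δ γ) : P.NonCrossing γ δ := by
  by_contra hcross
  obtain ⟨x, hx, h_eq⟩ := P.not_nonCrossing_iff.1 hcross
  have overlap : Overlap γ δ := P.fst_lt_iff.1 (hx.1.trans hx.2)
  rw [← openSegment_eq_Ioo (hx.1.trans hx.2)] at hx
  obtain ⟨s, t, hs, ht, hst, rfl⟩ := hx
  rw [smul_eq_mul, smul_eq_mul, P.height_add γ hst, P.height_add δ hst] at h_eq
  rcases P.height_left_eq_or_lt overlap with ⟨heq, hl⟩ | ⟨starts, hl⟩ | ⟨starts, hl⟩ <;>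
    rcases P.height_right_eq_or_lt overlap with ⟨heq', hr⟩ | ⟨ends, hr⟩ | ⟨ends, hr⟩
  · exact hne (Subtype.ext (Prod.ext heq heq'))
  · nlinarith
  · nlinarith
  · nlinarith
  · exact hγδ ⟨overlap, starts, ends⟩
  · nlinarith
  · nlinarith
  · nlinarith
  · exact hδγ ⟨overlap_comm.1 overlap, starts, ends⟩

lemma nonCrossing_iff (hne : γ ≠ δ) :
    P.NonCrossing γ δ ↔ ¬ Q.CrossesUp γ δ ∧ ¬ Q.CrossesUp δ γ :=
  ⟨fun h => ⟨fun hcross => P.not_nonCrossing_of_crossesUp hcross h,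
    fun hcross => P.not_nonCrossing_of_crossesUp hcross h.symm⟩,
    fun h => P.nonCrossing_of_not_crossesUp hne h.1 h.2⟩

end Polygon

lemma eta_isTriangulation (P : Q.Polygon) (π : Equiv.Perm (Fin (n + 1))) :
    P.IsTriangulation (Q.eta π : Set (Segment n)) := by
  refine ⟨fun γ hγ δ hδ hne => (P.nonCrossing_iff hne).2
    ⟨not_crossesUp_of_mem_eta hγ hδ, not_crossesUp_of_mem_eta hδ hγ⟩, fun S hS hle γ hγ => ?_⟩
  refine mem_eta_of_forall_not_crossesUp fun δ hδ => ?_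
  obtain rfl | hne := eq_or_ne γ δ
  · exact ⟨not_crossesUp_of_mem_eta hδ hδ, not_crossesUp_of_mem_eta hδ hδ⟩
  · exact (P.nonCrossing_iff hne).1 (hS hγ (hle hδ) hne)

end TypeAQuiver

/-! ## Degenerations -/

namespace QuiverRep

variable {k : Type u} [Field k] {V : Type v} [Quiver.{w} V]

lemma eval_eq_zero_of_eval_line_eq_zero [Infinite k] {W : Type*} [AddCommGroup W] [Module k W]
    (p : MvPolynomial (Module.Dual k W) k) (m d : W)
    (h : ∀ t : k, t ≠ 0 → MvPolynomial.eval (fun φ => φ (m + t • d)) p = 0) :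
    MvPolynomial.eval (fun φ => φ m) p = 0 := by
  let q : Polynomial k := MvPolynomial.eval₂ Polynomial.C
    (fun φ => Polynomial.C (φ m) + Polynomial.X * Polynomial.C (φ d)) p
  have eval_q (t : k) : q.eval t = MvPolynomial.eval (fun φ => φ (m + t • d)) p := by
    have evalRingHom_comp_C : (Polynomial.evalRingHom t).comp Polynomial.C = RingHom.id k := by
      ext
      simp
    rw [MvPolynomial.polynomial_eval_eval₂, evalRingHom_comp_C, MvPolynomial.eval₂_id]
    simp [mul_comm t]
  have q_eq_zero : q = 0 :=
    Polynomial.eq_zero_of_infinite_isRoot q ((Set.finite_singleton (0 : k)).infinite_compl.mono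
      fun t ht => (eval_q t).trans (h t ht))
  simpa [q_eq_zero] using (eval_q 0).symm

/-- The representation that agrees with `M` on the full subquiver with vertex set `s` and is zero
elsewhere. -/
noncomputable def restrict (M : QuiverRep k V) (s : Set V) : QuiverRep k V where
  space x := PLift (x ∈ s) → M.space x
  map {x y} a := by
    classical
    exact LinearMap.pi fun _ => if h : x ∈ s then M.map a ∘ₗ LinearMap.proj ⟨h⟩ else 0

/-- The projection from `M` to its restriction at the vertex `x`. -/
def toRestrict (M : QuiverRep k V) (s : Set V) (x : V) :
    M.space x →ₗ[k] (M.restrict s).space x :=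
  (LinearMap.pi fun _ => LinearMap.id : M.space x →ₗ[k] PLift (x ∈ s) → M.space x)

open scoped Classical in
/-- The inclusion of the restriction of `M` into `M` at the vertex `x`. -/
noncomputable def ofRestrict (M : QuiverRep k V) (s : Set V) (x : V) :
    (M.restrict s).space x →ₗ[k] M.space x :=
  (if h : x ∈ s then LinearMap.proj ⟨h⟩ else 0 : (PLift (x ∈ s) → M.space x) →ₗ[k] M.space x)

open scoped Classical in
/-- The map of `M` on an arrow within `s` or within the complement of `s`, and zero on an arrow
between the two. -/
noncomputable def splitMap (M : QuiverRep k V) (s : Set V) {x y : V} (a : x ⟶ y) :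
    M.space x →ₗ[k] M.space y :=
  if x ∈ s ↔ y ∈ s then M.map a else 0

/-- The representation obtained from `M` by replacing the maps on the arrows between `s` and its
complement by zero; it is the direct sum of the restrictions of `M` to `s` and to `sᶜ`. -/
noncomputable def split (M : QuiverRep k V) (s : Set V) : QuiverRep k V :=
  M.withMaps fun _ _ a => M.splitMap s a

section Restrict

variable {M : QuiverRep k V} {s : Set V} {x y : V}

lemma ofRestrict_eq_zero (h : x ∉ s) : M.ofRestrict s x = 0 := dif_neg h

lemma toRestrict_eq_zero (h : x ∉ s) : M.toRestrict s x = 0 :=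
  LinearMap.ext fun _ => funext fun ⟨hx⟩ => absurd hx h

lemma ofRestrict_toRestrict (h : x ∈ s) (m : M.space x) :
    M.ofRestrict s x (M.toRestrict s x m) = m := by
  rw [ofRestrict, dif_pos h]
  rfl

lemma toRestrict_ofRestrict (m : (M.restrict s).space x) :
    M.toRestrict s x (M.ofRestrict s x m) = m := by
  funext ⟨h⟩
  rw [ofRestrict, dif_pos h]
  rfl

lemma restrict_map (a : x ⟶ y) :
    (M.restrict s).map a = M.toRestrict s y ∘ₗ M.map a ∘ₗ M.ofRestrict s x := by
  refine LinearMap.ext fun m => funext fun _ => ?_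
  by_cases h : x ∈ s
  · simp only [restrict, toRestrict, ofRestrict, dif_pos h]
    rfl
  · simp only [restrict, toRestrict, ofRestrict, dif_neg h]
    exact (map_zero (M.map a)).symm

lemma splitMap_of_iff (a : x ⟶ y) (h : x ∈ s ↔ y ∈ s) : M.splitMap s a = M.map a := if_pos h

lemma splitMap_of_not_iff (a : x ⟶ y) (h : ¬ (x ∈ s ↔ y ∈ s)) : M.splitMap s a = 0 := if_neg h

lemma splitMap_compl (a : x ⟶ y) : M.splitMap sᶜ a = M.splitMap s a := by
  unfold splitMap
  congr 1
  exact propext not_iff_not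

lemma split_compl : M.split sᶜ = M.split s := by
  simp only [split, splitMap_compl]

lemma restrict_map_comp_toRestrict (a : x ⟶ y) :
    (M.restrict s).map a ∘ₗ M.toRestrict s x = M.toRestrict s y ∘ₗ M.splitMap s a := by
  refine LinearMap.ext fun m => ?_
  simp only [restrict_map, LinearMap.comp_apply]
  by_cases hy : y ∈ s
  · by_cases hx : x ∈ s
    · rw [ofRestrict_toRestrict hx, splitMap_of_iff a (iff_of_true hx hy)]
    · rw [ofRestrict_eq_zero hx, splitMap_of_not_iff a fun h => hx (h.2 hy), LinearMap.zero_apply,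
        map_zero, LinearMap.zero_apply]
  · simp only [toRestrict_eq_zero hy, LinearMap.zero_apply]

lemma split_isomorphic : (M.split s).Isomorphic ((M.restrict s).sum (M.restrict sᶜ)) := by
  refine ⟨Iso.ofBijective
    ⟨fun x => (M.toRestrict s x).prod (M.toRestrict sᶜ x), fun {x y} a => LinearMap.ext fun m => ?_⟩
    fun x => ⟨fun (m m' : M.space x) h => ?_, fun m => ?_⟩⟩
  · have map_fst := LinearMap.congr_fun (M.restrict_map_comp_toRestrict (s := s) a) m
    have map_snd := LinearMap.congr_fun (M.restrict_map_comp_toRestrict (s := sᶜ) a) m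
    rw [splitMap_compl] at map_snd
    exact Prod.ext map_fst map_snd
  · by_cases hx : x ∈ s
    · exact congrFun (congrArg Prod.fst h) ⟨hx⟩
    · exact congrFun (congrArg Prod.snd h) ⟨hx⟩
  · by_cases hx : x ∈ s
    · exact ⟨m.1 ⟨hx⟩, Prod.ext rfl (funext fun ⟨h⟩ => absurd hx h)⟩
    · exact ⟨m.2 ⟨hx⟩, Prod.ext (funext fun ⟨h⟩ => absurd h hx) rfl⟩

end Restrict

/-- Every arrow from `s` to its complement acts as zero on `M`, i.e. the restriction of `M` to `s`
is a subrepresentation. -/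
def Stable (M : QuiverRep k V) (s : Set V) : Prop :=
  ∀ ⦃x y : V⦄ (a : x ⟶ y), x ∈ s → y ∉ s → M.map a = 0

namespace Stable

variable {M : QuiverRep k V} {s : Set V}

/-- The inclusion of the subrepresentation of `M` that is supported on `s`. -/
noncomputable def incl (h : M.Stable s) : Hom (M.restrict s) M where
  app := M.ofRestrict s
  comm {x y} a := LinearMap.ext fun m => by
    rw [restrict_map, LinearMap.comp_apply, LinearMap.comp_apply, LinearMap.comp_apply,
      LinearMap.comp_apply]
    by_cases hy : y ∈ s
    · rw [ofRestrict_toRestrict hy]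
    by_cases hx : x ∈ s
    · rw [h a hx hy, LinearMap.zero_apply, map_zero, map_zero]
    · rw [ofRestrict_eq_zero hx, LinearMap.zero_apply, map_zero, map_zero, map_zero]

/-- The projection of `M` onto its quotient by the subrepresentation that is supported on `s`. -/
noncomputable def proj (h : M.Stable s) : Hom M (M.restrict sᶜ) where
  app := M.toRestrict sᶜ
  comm {x y} a := by
    rw [restrict_map_comp_toRestrict, splitMap_compl]
    by_cases hy : y ∈ s
    · rw [toRestrict_eq_zero (not_not.2 hy), LinearMap.zero_comp, LinearMap.zero_comp]
    by_cases hx : x ∈ s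
    · rw [splitMap_of_not_iff a fun hxy => hy (hxy.1 hx), h a hx hy]
    · rw [splitMap_of_iff a (iff_of_false hx hy)]

lemma shortExact (h : M.Stable s) : ShortExact h.incl h.proj := by
  refine fun x => ⟨Function.LeftInverse.injective toRestrict_ofRestrict,
    Function.RightInverse.surjective toRestrict_ofRestrict, ?_⟩
  change LinearMap.range (M.ofRestrict s x) = LinearMap.ker (M.toRestrict sᶜ x)
  by_cases hx : x ∈ s
  · rw [toRestrict_eq_zero (not_not.2 hx), LinearMap.ker_zero, LinearMap.range_eq_top]
    exact Function.RightInverse.surjective (ofRestrict_toRestrict hx)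
  · rw [ofRestrict_eq_zero hx, LinearMap.range_zero, eq_comm, LinearMap.ker_eq_bot]
    exact Function.LeftInverse.injective (ofRestrict_toRestrict (s := sᶜ) hx)

lemma not_splits_proj (h : M.Stable s) {x y : V} (a : x ⟶ y) (hx : x ∉ s) (hy : y ∈ s)
    (ha : M.map a ≠ 0) : ¬ Splits h.proj := by
  rintro ⟨σ, hσ⟩
  refine ha (LinearMap.ext fun m => ?_)
  have section_eq : σ.app x (M.toRestrict sᶜ x m) = m :=
    Function.LeftInverse.injective (ofRestrict_toRestrict (s := sᶜ) hx)
      (LinearMap.congr_fun (hσ x) (M.toRestrict sᶜ x m))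
  rw [← section_eq, σ.comm_apply, restrict_map, toRestrict_eq_zero (not_not.2 hy),
    LinearMap.zero_comp, LinearMap.zero_apply, LinearMap.zero_apply, map_zero]

lemma isExtensionOf_split (h : M.Stable s) {x y : V} (a : x ⟶ y) (hx : x ∉ s) (hy : y ∈ s)
    (ha : M.map a ≠ 0) : M.IsExtensionOf (M.split s) :=
  ⟨_, _, h.incl, h.proj, split_isomorphic, h.shortExact, h.not_splits_proj a hx hy ha⟩

open scoped Classical in
/-- Multiplication by `t` on the complement of `s` turns `M` into a representation that differs
from `M` by the factor `t` on the arrows into `s` and tends to `M.split s` as `t` tends to `0`. -/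
lemma isDegenerationOf_split [Infinite k] (h : M.Stable s) : (M.split s).IsDegenerationOf M := by
  intro p hp
  let m₀ (x y : V) (a : x ⟶ y) : M.space x →ₗ[k] M.space y := M.splitMap s a
  let d (x y : V) (a : x ⟶ y) : M.space x →ₗ[k] M.space y := M.map a - M.splitMap s a
  refine eval_eq_zero_of_eval_line_eq_zero p m₀ d fun t ht => hp _ ?_
  let u (x : V) : k := if x ∈ s then 1 else t
  have u_ne_zero (x : V) : u x ≠ 0 := by
    unfold u
    split_ifs
    exacts [one_ne_zero, ht]
  refine ⟨⟨fun x => LinearEquiv.smulOfNeZero k (M.space x) (u x) (u_ne_zero x),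
    fun {x y} a (m : M.space x) => ?_⟩⟩
  change M.map a (u x • m) = u y • (M.splitMap s a m + t • (M.map a m - M.splitMap s a m))
  by_cases hxy : x ∈ s ↔ y ∈ s
  · have u_eq : u x = u y := by simp only [u, hxy]
    rw [splitMap_of_iff a hxy, sub_self, smul_zero, add_zero, map_smul, u_eq]
  · rw [splitMap_of_not_iff a hxy, LinearMap.zero_apply, sub_zero, zero_add, map_smul]
    by_cases hx : x ∈ s
    · rw [h a hx fun hy => hxy (iff_of_true hx hy), LinearMap.zero_apply, smul_zero, smul_zero,
        smul_zero]
    · have hy : y ∈ s := by_contra fun hy => hxy (iff_of_false hx hy)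
      simp only [u, if_neg hx, if_pos hy, one_smul]

end Stable

end QuiverRep

/-! ## The chain of representations -/

namespace TypeAQuiver

open QuiverRep

variable {n : ℕ} {Q : TypeAQuiver n} {k : Type u} [Field k]

section ThinRep

variable {S : Finset (Fin (n + 1))} {l : Fin (n + 1)}

lemma pos_le_iff_pos_le_iff {x y : Q.Vertex} (α : x ⟶ y) :
    (pos x ≤ l ↔ pos y ≤ l) ↔ Q.arrowIndex α ≠ l := by
  rw [Ne, Fin.ext_iff]
  rcases pos_of_arrow α with ⟨-, hx, hy⟩ | ⟨-, hx, hy⟩ <;> omega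

lemma thinRep_erase :
    thinRep k Q (S.erase l) = (thinRep k Q S).split {x | pos x ≤ l} := by
  have map_eq {x y : Q.Vertex} (α : x ⟶ y) : (thinRep k Q (S.erase l)).map α =
      (thinRep k Q S).splitMap {x | pos x ≤ l} α := by
    by_cases h : Q.arrowIndex α = l
    · rw [splitMap_of_not_iff α fun h' => (pos_le_iff_pos_le_iff α).1 h' h]
      exact if_neg fun h' => Finset.ne_of_mem_erase h' h
    · rw [splitMap_of_iff α ((pos_le_iff_pos_le_iff α).2 h)]
      exact if_congr (Finset.mem_erase.trans (and_iff_right h)) rfl rfl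
  exact congrArg (thinRep k Q S).withMaps (funext₃ fun _ _ α => map_eq α)

lemma stable_setOf_pos_le (X : QuiverRep k Q.Vertex) (hl : Q.forward l = false) :
    X.Stable {x | pos x ≤ l} := by
  intro x y α (hx : pos x ≤ l) (hy : ¬ pos y ≤ l)
  have hα : Q.arrowIndex α = l := by
    by_contra hα
    exact hy (((pos_le_iff_pos_le_iff α).2 hα).1 hx)
  rcases hα ▸ pos_of_arrow α with ⟨hl', -, -⟩ | ⟨-, hx', -⟩
  · simp [hl] at hl'
  · omega

lemma stable_compl_setOf_pos_le (X : QuiverRep k Q.Vertex) (hl : Q.forward l = true) :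
    X.Stable {x | pos x ≤ l}ᶜ := by
  intro x y α (hx : ¬ pos x ≤ l) (hy : ¬ ¬ pos y ≤ l)
  have hα : Q.arrowIndex α = l := by
    by_contra hα
    exact hy fun hy => hx (((pos_le_iff_pos_le_iff α).2 hα).2 hy)
  rcases hα ▸ pos_of_arrow α with ⟨-, hx', -⟩ | ⟨hl', -, -⟩
  · omega
  · simp [hl] at hl'

lemma thinRep_erase_isDegenerationOf [Infinite k] (hl : Q.forward l = true) :
    (thinRep k Q (S.erase l)).IsDegenerationOf (thinRep k Q S) := by
  rw [thinRep_erase, ← split_compl]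
  exact (stable_compl_setOf_pos_le _ hl).isDegenerationOf_split

lemma thinRep_insert_isExtensionOf (hS : l ∉ S) (hl : Q.forward l = false) :
    (thinRep k Q (insert l S)).IsExtensionOf (thinRep k Q S) := by
  have split_eq : thinRep k Q S = (thinRep k Q (insert l S)).split {x | pos x ≤ l} := by
    rw [← thinRep_erase, Finset.erase_insert hS]
  have map_eq_id : (thinRep k Q (insert l S)).map (Q.leftArrow l hl) = LinearMap.id :=
    if_pos (Finset.mem_insert_self l S)
  have map_ne_zero : (thinRep k Q (insert l S)).map (Q.leftArrow l hl) ≠ 0 := fun h =>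
    one_ne_zero (α := k) (LinearMap.congr_fun (map_eq_id.symm.trans h) (1 : k))
  exact split_eq ▸ (stable_setOf_pos_le _ hl).isExtensionOf_split (Q.leftArrow l hl)
    (show ¬ pos (Q.after l) ≤ l by simp) (show pos (Q.before l) ≤ l by simp) map_ne_zero

end ThinRep

section LambdaRep

variable {π : Equiv.Perm (Fin (n + 1))} {t : Fin (n + 2)} {γ δ : Segment n} {x y : Q.Vertex}

lemma exists_mem_path (π : Equiv.Perm (Fin (n + 1))) (t : Fin (n + 2)) (x : Q.Vertex) :
    ∃ γ ∈ Q.path π t, Mem x γ := by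
  have pos_lt := pos_lt x
  obtain ⟨i, hi, hi_max⟩ :=
    ((Q.pathVertices π t).filter fun c => c.val ≤ pos x).exists_max_image id
      ⟨0, by simp [zero_mem_pathVertices]⟩
  obtain ⟨j, hj, hj_min⟩ :=
    ((Q.pathVertices π t).filter fun c => pos x < c.val).exists_min_image id
      ⟨Fin.last _, by simp [last_mem_pathVertices, pos_lt]⟩
  simp only [Finset.mem_filter, id, and_imp] at hi hi_max hj hj_min
  refine ⟨⟨(i, j), Fin.lt_def.2 (hi.2.trans_lt hj.2)⟩, mem_path.2 ⟨hi.1, hj.1, fun c hc h => ?_⟩,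
    mem_iff.2 ⟨hi.2, hj.2⟩⟩
  rcases le_or_gt c.val (pos x) with hcx | hcx
  · exact absurd (hi_max c hc hcx) (not_le.2 h.1)
  · exact absurd (hj_min c hc hcx) (not_le.2 h.2)

lemma eq_of_mem_path (hγ : γ ∈ Q.path π t) (hδ : δ ∈ Q.path π t) (hxγ : Mem x γ)
    (hxδ : Mem x δ) : γ = δ := by
  obtain ⟨hγ₁, hγ₂, hγ⟩ := mem_path.1 hγ
  obtain ⟨hδ₁, hδ₂, hδ⟩ := mem_path.1 hδ
  rw [mem_iff] at hxγ hxδ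
  have h₁ := hγ _ hδ₁
  have h₂ := hγ _ hδ₂
  have h₃ := hδ _ hγ₁
  have h₄ := hδ _ hγ₂
  rw [Fin.lt_def, Fin.lt_def] at h₁ h₂ h₃ h₄
  apply segment_ext <;> omega

/-- The path passes through the polygon vertex of the arrow only if this vertex is the end point of
`γ` at which the arrow enters the support of `F(γ)`. -/
lemma arrowIndex_mem_identityArrows_iff (hγ : γ ∈ Q.path π t) (α : x ⟶ y) (hy : Mem y γ) :
    Q.arrowIndex α ∈ Q.identityArrows π t ↔ Mem x γ := by
  obtain ⟨hγ₁, hγ₂, hγ⟩ := mem_path.1 hγ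
  rw [mem_identityArrows, ← polygonVertex_mem_pathVertices]
  rw [mem_iff] at hy ⊢
  have hα := pos_of_arrow α
  have val_eq := val_polygonVertex (Q.arrowIndex α)
  constructor
  · intro h
    have h₁ : polygonVertex (Q.arrowIndex α) ≠ γ.1.1 := fun e => h (e ▸ hγ₁)
    have h₂ : polygonVertex (Q.arrowIndex α) ≠ γ.1.2 := fun e => h (e ▸ hγ₂)
    rw [Ne, Fin.ext_iff, val_eq] at h₁ h₂
    omega
  · intro hx h
    apply hγ _ h
    rw [Fin.lt_def, Fin.lt_def, val_eq]
    omega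

/-- The projection of `λ_t^rep(π)` to the summand `F(γ)` for a segment `γ` of the path `λ_t(π)`. -/
noncomputable def toSegmentRep (hγ : γ ∈ Q.path π t) :
    Hom (Q.lambdaRep k π t) (segmentRep k Q γ) :=
  homOfForms _ _ (fun x => (if Mem x γ then LinearMap.id else 0 : k →ₗ[k] k))
    (fun _ hx => if_neg hx) fun {x y} α hy => by
    have form_eq_id : (if Mem y γ then LinearMap.id else 0 : k →ₗ[k] k) = LinearMap.id := if_pos hy
    rw [form_eq_id]
    exact if_congr (arrowIndex_mem_identityArrows_iff hγ α hy) rfl rfl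

lemma val_toSegmentRep_app (hγ : γ ∈ Q.path π t) (hx : Mem x γ) (c : k) :
    val ((toSegmentRep (k := k) hγ).app x c) = c :=
  LinearMap.congr_fun (if_pos hx : (if Mem x γ then LinearMap.id else 0 : k →ₗ[k] k) = _) c

/-- At every vertex exactly one of the summands `F(γ)` is nonzero, as the path passes from left to
right without gaps. -/
lemma lambdaRep_isomorphic (π : Equiv.Perm (Fin (n + 1))) (t : Fin (n + 2)) :
    (Q.lambdaRep k π t).Isomorphic (FSet k Q (Q.path π t)) := by
  refine ⟨Iso.ofBijective ⟨fun x => LinearMap.pi fun γ => (toSegmentRep γ.2).app x, fun {x y} α =>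
    LinearMap.ext fun c => funext fun γ => (toSegmentRep γ.2).comm_apply α c⟩ fun x => ?_⟩
  obtain ⟨γ, hγ, hx⟩ := exists_mem_path π t x
  refine ⟨fun (c c' : k) h => ?_, fun m => ⟨(val (m ⟨γ, hγ⟩ : (segmentRep k Q γ).space x) : k),
    funext fun ⟨δ, hδ⟩ => val_injective ?_⟩⟩
  · have val_eq := congrArg val (congrFun h ⟨γ, hγ⟩)
    exact (val_toSegmentRep_app hγ hx c).symm.trans (val_eq.trans (val_toSegmentRep_app hγ hx c'))
  · by_cases hxδ : Mem x δ
    · obtain rfl := eq_of_mem_path hδ hγ hxδ hx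
      exact val_toSegmentRep_app hδ hx _
    · exact (val_eq_zero _ hxδ).trans (val_eq_zero _ hxδ).symm

end LambdaRep

end TypeAQuiver

namespace TypeAQuiver

open QuiverRep

variable {n : ℕ} {Q : TypeAQuiver n} {k : Type u} [Field k] {π : Equiv.Perm (Fin (n + 1))}
  {i : Fin (n + 1)} {T : Finset (Segment n)} {X : QuiverRep k Q.Vertex}

lemma succ_identityArrows_of_mem_upper (hi : π i ∈ Q.upper) :
    Q.identityArrows π i.succ = (Q.identityArrows π i.castSucc).erase (π i) :=
  (Fin.induction_succ ..).trans (if_pos hi)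

lemma succ_identityArrows_of_mem_lower (hi : π i ∈ Q.lower) :
    Q.identityArrows π i.succ = insert (π i) (Q.identityArrows π i.castSucc) :=
  (Fin.induction_succ ..).trans (if_neg (by simp [mem_upper, mem_lower.1 hi]))

lemma mem_castSucc_identityArrows_iff :
    π i ∈ Q.identityArrows π i.castSucc ↔ π i ∈ Q.upper := by
  simp [mem_identityArrows, mem_pathSupport]

lemma lambdaRep_succ_isDegenerationOf [Infinite k] (hi : π i ∈ Q.upper) :
    (Q.lambdaRep k π i.succ).IsDegenerationOf (Q.lambdaRep k π i.castSucc) := by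
  rw [lambdaRep, lambdaRep, succ_identityArrows_of_mem_upper hi]
  exact thinRep_erase_isDegenerationOf (mem_upper.1 hi)

lemma castSucc_identityArrows_notMem (hi : π i ∈ Q.lower) :
    π i ∉ Q.identityArrows π i.castSucc := by
  simp [mem_castSucc_identityArrows_iff, mem_upper, mem_lower.1 hi]

lemma lambdaRep_succ_isExtensionOf (hi : π i ∈ Q.lower) :
    (Q.lambdaRep k π i.succ).IsExtensionOf (Q.lambdaRep k π i.castSucc) := by
  rw [lambdaRep, lambdaRep, succ_identityArrows_of_mem_lower hi]
  exact thinRep_insert_isExtensionOf (castSucc_identityArrows_notMem hi) (mem_lower.1 hi)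

lemma identityArrows_last (π : Equiv.Perm (Fin (n + 1))) :
    Q.identityArrows π (Fin.last (n + 1)) = Q.lower := by
  ext l
  simp [mem_identityArrows, mem_pathSupport, mem_upper, mem_lower, Fin.castSucc_lt_last]

lemma isIndecSummand_lambdaRep_iff {t : Fin (n + 2)} :
    X.IsIndecSummand (Q.lambdaRep k π t) ↔ ∃ γ ∈ Q.path π t, X.Isomorphic (segmentRep k Q γ) := by
  rw [← isIndecSummand_FSet_iff]
  exact and_congr_right fun _ => ⟨fun h => h.of_isRetract (lambdaRep_isomorphic π t).isRetract,
    fun h => h.of_isRetract (lambdaRep_isomorphic π t).symm.isRetract⟩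

lemma isIndecSummand_etaRep_iff :
    X.IsIndecSummand (Q.etaRep k π) ↔ ∃ t, X.IsIndecSummand (Q.lambdaRep k π t) := by
  simp only [etaRep, isIndecSummand_FSet_iff, isIndecSummand_lambdaRep_iff, mem_eta, mem_path]
  exact ⟨fun ⟨γ, ⟨t, hγ⟩, h⟩ => ⟨t, γ, hγ, h⟩, fun ⟨t, γ, hγ, h⟩ => ⟨γ, ⟨t, hγ⟩, h⟩⟩

lemma almostRigid_FSet_iff :
    (FSet k Q T).AlmostRigid ↔ ∀ γ ∈ T, ∀ δ ∈ T, ¬ Q.CrossesUp γ δ := by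
  refine ⟨fun h γ hγ δ hδ => ?_, fun h => ⟨basic_FSet T, fun A B hA hB => ?_⟩⟩
  · exact extCompatible_segmentRep_iff.1 <| h.2 _ _
      (isIndecSummand_FSet_iff.2 ⟨γ, hγ, Isomorphic.refl _⟩)
      (isIndecSummand_FSet_iff.2 ⟨δ, hδ, Isomorphic.refl _⟩)
  · obtain ⟨γ, hγ, hA⟩ := isIndecSummand_FSet_iff.1 hA
    obtain ⟨δ, hδ, hB⟩ := isIndecSummand_FSet_iff.1 hB
    exact (extCompatible_segmentRep_iff.2 (h γ hγ δ hδ)).of_isomorphic hA.symm hB.symm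

lemma segmentRep_isRetract_FSet {γ : Segment n} (hγ : γ ∈ T) :
    (segmentRep k Q γ).IsRetract (FSet k Q T) :=
  isRetract_directSum (fun γ : T => F k Q γ) ⟨γ, hγ⟩

lemma etaRep_maximalAlmostRigid (π : Equiv.Perm (Fin (n + 1))) :
    (Q.etaRep k π).MaximalAlmostRigid := by
  refine ⟨almostRigid_FSet_iff.2 fun γ hγ δ hδ => not_crossesUp_of_mem_eta hγ hδ,
    fun X hX hsum => ?_⟩
  obtain ⟨γ, hγX⟩ := exists_segmentRep_isRetract hX
  have summand_γ : (segmentRep k Q γ).IsIndecSummand ((Q.etaRep k π).sum X) :=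
    ⟨segmentRep_indecomposable γ, isSummand_iff_isRetract.2 (hγX.trans isRetract_sum_right)⟩
  have summand (δ : Segment n) (hδ : δ ∈ Q.eta π) :
      (segmentRep k Q δ).IsIndecSummand ((Q.etaRep k π).sum X) :=
    ⟨segmentRep_indecomposable δ,
      isSummand_iff_isRetract.2 ((segmentRep_isRetract_FSet hδ).trans isRetract_sum_left)⟩
  have hγ : γ ∈ Q.eta π := mem_eta_of_forall_not_crossesUp fun δ hδ =>
    ⟨extCompatible_segmentRep_iff.1 (hsum.2 _ _ summand_γ (summand δ hδ)),
      extCompatible_segmentRep_iff.1 (hsum.2 _ _ (summand δ hδ) summand_γ)⟩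
  exact hsum.1 _ (segmentRep_indecomposable γ)
    (isSummand_iff_isRetract.2 ((segmentRep_isRetract_FSet hγ).sum hγX))

lemma isomorphic_FSet_of_isIndecSummand_iff (hX : X.Basic)
    (h : ∀ Y : QuiverRep k Q.Vertex, Y.IsIndecSummand X ↔ Y.IsIndecSummand (FSet k Q T)) :
    X.Isomorphic (FSet k Q T) := by
  refine isomorphic_FSet_of_basic hX fun γ => ?_
  have retract_iff := h (segmentRep k Q γ)
  rw [IsIndecSummand, IsIndecSummand, and_congr_right_iff, isSummand_iff_isRetract,
    isSummand_iff_isRetract] at retract_iff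
  rw [retract_iff (segmentRep_indecomposable γ)]
  refine segmentRep_isRetract_directSum_iff.trans ?_
  exact ⟨fun ⟨δ, hδ⟩ => hδ ▸ δ.2, fun hγ => ⟨⟨γ, hγ⟩, rfl⟩⟩

end TypeAQuiver

theorem mainTheorem7_general (k : Type u) [Field k] [Infinite k] (n : ℕ) (Q : TypeAQuiver n)
    (π : Equiv.Perm (Fin (n + 1))) :
    (∀ P : Q.Polygon, P.IsTriangulation (Q.eta π : Set (TypeAQuiver.Segment n))) ∧
    (∀ i : Fin (n + 1), π i ∈ Q.upper →
      π i ∈ Q.identityArrows π i.castSucc ∧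
      (Q.lambdaRep k π i.succ).IsDegenerationOf (Q.lambdaRep k π i.castSucc)) ∧
    (∀ i : Fin (n + 1), π i ∈ Q.lower →
      π i ∉ Q.identityArrows π i.castSucc ∧
      (Q.lambdaRep k π i.succ).IsExtensionOf (Q.lambdaRep k π i.castSucc)) ∧
    Q.identityArrows π (Fin.last (n + 1)) = Q.lower ∧
    (Q.etaRep k π).MaximalAlmostRigid ∧
    (∀ X : QuiverRep k Q.Vertex,
      X.IsIndecSummand (Q.etaRep k π) ↔ ∃ i, X.IsIndecSummand (Q.lambdaRep k π i)) ∧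
    (∀ T : QuiverRep k Q.Vertex, T.MaximalAlmostRigid →
      (∀ X : QuiverRep k Q.Vertex,
        X.IsIndecSummand T ↔ ∃ i, X.IsIndecSummand (Q.lambdaRep k π i)) →
      T.Isomorphic (Q.etaRep k π)) := by
  open TypeAQuiver in
  refine ⟨fun P => eta_isTriangulation P π, fun i hi => ?_, fun i hi => ?_, identityArrows_last π,
    etaRep_maximalAlmostRigid π, fun X => isIndecSummand_etaRep_iff, fun T hT hX => ?_⟩
  · exact ⟨mem_castSucc_identityArrows_iff.2 hi, lambdaRep_succ_isDegenerationOf hi⟩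
  · exact ⟨castSucc_identityArrows_notMem hi, lambdaRep_succ_isExtensionOf hi⟩
  · exact isomorphic_FSet_of_isIndecSummand_iff hT.1.1 fun X =>
      (hX X).trans isIndecSummand_etaRep_iff.symm

theorem mainTheorem7 (k : Type u) [Field k] [IsAlgClosed k] (n : ℕ) (Q : TypeAQuiver n)
    (π : Equiv.Perm (Fin (n + 1))) :
    -- `η_Q(π)` is a triangulation of the polygon `P(Q)`
    (∀ P : Q.Polygon, P.IsTriangulation (Q.eta π : Set (TypeAQuiver.Segment n))) ∧
    -- the chain `λ_0^rep(π), …, λ_{n+1}^rep(π)`: its steps are degenerations and extensions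
    (∀ i : Fin (n + 1), π i ∈ Q.upper →
      π i ∈ Q.identityArrows π i.castSucc ∧
      (Q.lambdaRep k π i.succ).IsDegenerationOf (Q.lambdaRep k π i.castSucc)) ∧
    (∀ i : Fin (n + 1), π i ∈ Q.lower →
      π i ∉ Q.identityArrows π i.castSucc ∧
      (Q.lambdaRep k π i.succ).IsExtensionOf (Q.lambdaRep k π i.castSucc)) ∧
    -- it ends with the zero map on the upper-barred arrows and the identity on the lower-barred ones
    Q.identityArrows π (Fin.last (n + 1)) = Q.lower ∧
    -- `η_Q^rep(π)` is maximal almost rigid, its indecomposable summands are those of the chain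
    (Q.etaRep k π).MaximalAlmostRigid ∧
    (∀ X : QuiverRep k Q.Vertex,
      X.IsIndecSummand (Q.etaRep k π) ↔ ∃ i, X.IsIndecSummand (Q.lambdaRep k π i)) ∧
    -- and it is the only one, up to isomorphism
    (∀ T : QuiverRep k Q.Vertex, T.MaximalAlmostRigid →
      (∀ X : QuiverRep k Q.Vertex,
        X.IsIndecSummand T ↔ ∃ i, X.IsIndecSummand (Q.lambdaRep k π i)) →
      T.Isomorphic (Q.etaRep k π)) :=
  mainTheorem7_general k n Q π
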